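/- Let $(M,g)$ be a smooth Riemannian manifold of dimension $n$ (without boundary), with Riemann curvature tensor $R$. On each tangent space $V=T_mM$ consider the algebra of double forms $\mathcal D=\Lambda^*V\otimes\Lambda^*V=\bigoplus_{p,p'}\mathcal D^{p,p'}$, $\mathcal D^{p,p'}=\Lambda^{*p}V\otimes\Lambda^{*p'}V$, with product $(\theta_1\otimes\theta_2)(\theta_3\otimes\theta_4)=(\theta_1\wedge\theta_3)\otimes(\theta_2\wedge\theta_4)$. Here $g\in\mathcal D^{1,1}$ and $R\in\mathcal D^{2,2}$, where $R(x\wedge y,x\wedge y)$ is the sectional curvature for orthonormal $x,y$. The contraction is $(c\,\omega)(x,y)=\sum_j\omega(e_j\wedge x,e_j\wedge y)$ for an orthonormal basis $(e_j)$, and the Hodge star is $*(\theta_1\otimes\theta_2)=*\theta_1\otimes *\theta_2$. The sectional curvature of $\omega\in\mathcal D^{p,p}$ at a $p$-plane $P\subset V$ with orthonormal basis $e_1,\dots,e_p$ is $K_\omega(P)=\omega(e_1\wedge\dots\wedge e_p,e_1\wedge\dots\wedge e_p)$. For $1\le q\le n/2$ and $0\le p\le n-2q$, the $(p,q)$-curvature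 $s_{(p,q)}(P)$ of a tangent $p$-plane $P$ is the sectional curvature at $P$ of $$R_{(p,q)}=\frac1{(n-2q-p)!}*\bigl(g^{\,n-2q-p}R^q\bigr).$$ Let $q\ge1$ and $2q\le r\le n-2q$. Then at every point $R^q$ can be written as $R^q=\sum_{i=0}^{2q}g^{2q-i}\omega_i$ with $\omega_i\in\mathcal D^{i,i}$ and $c\,\omega_i=0$. Let the $\omega_i$ be such components at each point ($\omega_0$ is a scalar), let $S\subseteq M$ be a non-empty set of points (for instance $S=M$, or a single point), and let $\lambda\in\mathbb R$. Below, $P$ ranges over all $r$-dimensional subspaces of $T_mM$ with $m\in S$, $P^\perp$ is the orthogonal complement of $P$ in $T_mM$, and the conditions on $\omega_i$ are required at all points of $S$. 1. Suppose $n\neq 2r$. (a) $s_{(r,q)}(P)-s_{(n-r,q)}(P^\perp)=\lambda$ for all $P$ if and only if $\omega_i=0$ for $1\le i\le 2q-1$ and $\left(\frac{(n-r)!}{(n-2q-r)!}-\frac{r!}{(r-2q)!}\right)\omega_0=\lambda$. (b) $s_{(r,q)}(P)+s_{(n-r,q)}(P^\perp)=\lambda$ for all $P$ if and only if $\omega_i=0$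 for $1\le i\le 2q$ and $\left(\frac{(n-r)!}{(n-2q-r)!}+\frac{r!}{(r-2q)!}\right)\omega_0=\lambda$. Moreover, such a constant $\lambda$ exists if and only if $R^q$ has constant sectional curvature over $S$, that is, $K_{R^q}$ takes one and the same value on all $2q$-dimensional subspaces of the spaces $T_mM$, $m\in S$. 2. Suppose $n=2r$. (a) $s_{(r,q)}(P)-s_{(r,q)}(P^\perp)=\lambda$ for all $P$ if and only if $\omega_i=0$ for all odd $i$ with $1\le i\le 2q-1$, and $\lambda=0$. (b) $s_{(r,q)}(P)+s_{(r,q)}(P^\perp)=\lambda$ for all $P$ if and only if $\omega_i=0$ for all even $i$ with $2\le i\le 2q$, and $\frac{2\,r!}{(r-2q)!}\,\omega_0=\lambda$. -/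

import Mathlib

open Module Manifold Bundle TensorProduct
open scoped ContDiff Nat

noncomputable section

/-! ### The algebra of double forms on a Euclidean vector space -/

namespace DoubleForms

section Algebra

variable (V : Type*) [NormedAddCommGroup V] [InnerProductSpace ℝ V]

/-- The exterior algebra `Λ V*` of forms on `V`. -/
abbrev Form : Type _ := ExteriorAlgebra ℝ (Module.Dual ℝ V)

/-- The algebra of double forms `Λ V* ⊗ Λ V*`, with Mathlib's multiplication
`(θ₁ ⊗ θ₂) * (θ₃ ⊗ θ₄) = (θ₁ ∧ θ₃) ⊗ (θ₂ ∧ θ₄)` of the tensor product of two algebras. -/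
abbrev DForm : Type _ := Form V ⊗[ℝ] Form V

/-- The subspace `D^{p,q} = Λ^p V* ⊗ Λ^q V*` of double forms of bidegree `(p, q)`. -/
def bidegree (p q : ℕ) : Submodule ℝ (DForm V) :=
  LinearMap.range (TensorProduct.map (⋀[ℝ]^p (Module.Dual ℝ V)).subtype
    (⋀[ℝ]^q (Module.Dual ℝ V)).subtype)

variable {V}

/-- The one-form `⟨v, ·⟩`, as an element of the exterior algebra. -/
def flat (v : V) : Form V := ExteriorAlgebra.ι ℝ (innerₗ V v)

/-- The interior product `θ ↦ θ(v ∧ ·)` of forms by a vector `v`. -/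
def interior (v : V) : Form V →ₗ[ℝ] Form V :=
  CliffordAlgebra.contractLeft (Q := (0 : QuadraticForm ℝ (Module.Dual ℝ V)))
    (Module.Dual.eval ℝ V v)

/-- The value `θ(x₁ ∧ … ∧ x_p)` of (the component of degree `p` of) a form: the scalar
`ι_{x_p} ⋯ ι_{x_1} θ`. -/
def evalForm {p : ℕ} (x : Fin p → V) : Form V →ₗ[ℝ] ℝ :=
  ExteriorAlgebra.algebraMapInv.toLinearMap ∘ₗ
    ((List.ofFn fun i => (interior (x i) : Module.End ℝ (Form V))).reverse.prod)

/-- The value `η(x₁ ∧ … ∧ x_p, y₁ ∧ … ∧ y_q)` of a double form. -/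
def evalDForm {p q : ℕ} (x : Fin p → V) (y : Fin q → V) : DForm V →ₗ[ℝ] ℝ :=
  LinearMap.mul' ℝ ℝ ∘ₗ TensorProduct.map (evalForm x) (evalForm y)

variable [FiniteDimensional ℝ V]

variable (V) in
/-- The metric, as a double form of bidegree `(1, 1)`. -/
def metric : DForm V :=
  ∑ i, flat (stdOrthonormalBasis ℝ V i) ⊗ₜ[ℝ] flat (stdOrthonormalBasis ℝ V i)

/-- The contraction `c : D^{p+1,q+1} → D^{p,q}`,
`(c η)(x, y) = ∑ j, η(e_j ∧ x, e_j ∧ y)` for an orthonormal basis `e`. -/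
def contraction : DForm V →ₗ[ℝ] DForm V :=
  ∑ j, TensorProduct.map (interior (stdOrthonormalBasis ℝ V j))
    (interior (stdOrthonormalBasis ℝ V j))

variable (V) in
/-- The volume form `e¹ ∧ … ∧ eⁿ` of the chosen orthonormal basis. Its sign depends on the
basis; the double Hodge star below does not. -/
def volForm : Form V :=
  ExteriorAlgebra.ιMulti ℝ (finrank ℝ V) fun i => innerₗ V (stdOrthonormalBasis ℝ V i)

/-- The vector `θ♯` with `⟨θ♯, ·⟩ = θ`. -/
def sharp (θ : Module.Dual ℝ V) : V :=
  ∑ i, θ (stdOrthonormalBasis ℝ V i) • stdOrthonormalBasis ℝ V i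

variable (V) in
/-- The map `θ ↦ ι_{θ♯}` into the opposite of the algebra of endomorphisms of `Λ V*`. -/
def interiorSharp : Module.Dual ℝ V →ₗ[ℝ] (Module.End ℝ (Form V))ᵐᵒᵖ where
  toFun θ := MulOpposite.op (interior (sharp θ))
  map_add' a b := by
    simp [sharp, interior, add_smul, Finset.sum_add_distrib]
  map_smul' a b := by
    simp [sharp, interior, mul_smul, Finset.smul_sum]

theorem interiorSharp_sq (θ : Module.Dual ℝ V) :
    interiorSharp V θ * interiorSharp V θ = 0 := by
  apply MulOpposite.unop_injective
  ext x
  simp [interiorSharp, interior, CliffordAlgebra.contractLeft_contractLeft]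

/-- The Hodge star on forms:
`*(θ₁ ∧ … ∧ θ_p) = ι_{θ_p♯} ⋯ ι_{θ_1♯} vol = vol(θ_1♯, …, θ_p♯, ·)`. -/
def hodge : Form V →ₗ[ℝ] Form V :=
  LinearMap.flip
    ((MulOpposite.opLinearEquiv ℝ (M := Module.End ℝ (Form V))).symm.toLinearMap ∘ₗ
      (ExteriorAlgebra.lift ℝ ⟨interiorSharp V, interiorSharp_sq⟩).toLinearMap) (volForm V)

/-- The Hodge star on double forms, `*(θ₁ ⊗ θ₂) = *θ₁ ⊗ *θ₂`. -/
def star : DForm V →ₗ[ℝ] DForm V := TensorProduct.map hodge hodge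

/-- The sectional curvature `K_η(P) = η(e₁ ∧ … ∧ e_p, e₁ ∧ … ∧ e_p)` of a double form at a
`p`-plane `P`, where `e` is an orthonormal basis of `P` and `p = dim P`. -/
def sectional (η : DForm V) (P : Submodule ℝ V) : ℝ :=
  evalDForm (fun i => (stdOrthonormalBasis ℝ P i : V)) (fun i => (stdOrthonormalBasis ℝ P i : V)) η

/-- The double form of bidegree `(2, 2)` with values `T(x, y, z, w)` at `(x ∧ y, z ∧ w)`, for a
quadrilinear `T` that is skew in the first two and in the last two arguments. -/
def ofTensor (T : V → V → V → V → ℝ) : DForm V :=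
  let e := stdOrthonormalBasis ℝ V
  (1 / 4 : ℝ) • ∑ i, ∑ j, ∑ k, ∑ l,
    T (e i) (e j) (e k) (e l) •
      ((flat (e i) * flat (e j)) ⊗ₜ[ℝ] (flat (e k) * flat (e l)))

/-- The `(p, q)`-curvature tensor `(1 / (n - 2q - p)!) * (g^{n-2q-p} R^q)` associated with
a curvature tensor `R`, where `*` is the Hodge star and `n = dim V`
(meaningful for `2q + p ≤ n`). -/
def pqTensor (R : DForm V) (p q : ℕ) : DForm V :=
  ((finrank ℝ V - 2 * q - p)! : ℝ)⁻¹ • star (metric V ^ (finrank ℝ V - 2 * q - p) * R ^ q)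

/-- `η₀, …, η_p` are the components of `Ω ∈ D^{p,p}`: each `η_i` is an effective element of
`D^{i,i}` (that is, `c η_i = 0`), and `Ω = ∑ g^{p-i} η_i`. -/
structure IsEffectiveDecomposition (p : ℕ) (Ω : DForm V) (η : ℕ → DForm V) : Prop where
  mem : ∀ i ≤ p, η i ∈ bidegree V i i
  effective : ∀ i ≤ p, contraction (η i) = 0
  sum_eq : Ω = ∑ i ∈ Finset.range (p + 1), metric V ^ (p - i) * η i

end Algebra

end DoubleForms

/-! ### The Riemann curvature tensor in a chart -/

namespace RiemannCurv

section Local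

variable {E : Type*} [NormedAddCommGroup E] [NormedSpace ℝ E]

/-- The linear form `w ↦ ⟨Γ(u, v), w⟩ = (∂_u G(v, w) + ∂_v G(u, w) - ∂_w G(u, v)) / 2`, for a metric
`G` on an open subset of the vector space `E`. -/
def christoffelFirst (G : E → E →L[ℝ] E →L[ℝ] ℝ) (y u v : E) : E →L[ℝ] ℝ :=
  (1 / 2 : ℝ) • (fderiv ℝ G y u v + fderiv ℝ G y v u - ((fderiv ℝ G y).flip u).flip v)

/-- The Christoffel symbol `Γ(u, v) = ∇_u v` of the Levi-Civita connection, for constant vector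
fields `u` and `v`. -/
def christoffel (G : E → E →L[ℝ] E →L[ℝ] ℝ) (y u v : E) : E :=
  (G y).inverse (christoffelFirst G y u v)

/-- The curvature operator `R(u, v) w = ∇_u ∇_v w - ∇_v ∇_u w`, for constant vector fields
`u`, `v` and `w`. -/
def curvatureOperator (G : E → E →L[ℝ] E →L[ℝ] ℝ) (y u v w : E) : E :=
  fderiv ℝ (fun z => christoffel G z v w) y u - fderiv ℝ (fun z => christoffel G z u w) y v
    + christoffel G y u (christoffel G y v w) - christoffel G y v (christoffel G y u w)

end Local

section Manifold

variable {E : Type*} [NormedAddCommGroup E] [NormedSpace ℝ E]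
  {M : Type*} [TopologicalSpace M] [ChartedSpace E M] [IsManifold 𝓘(ℝ, E) ∞ M]
  [RiemannianBundle (fun x : M => TangentSpace 𝓘(ℝ, E) x)]

/-- The Riemannian metric in the chart at `m`, as a function on (the target of the chart in) `E`. -/
def metricInChart (m : M) (y : E) : E →L[ℝ] E →L[ℝ] ℝ :=
  let x : M := (extChartAt 𝓘(ℝ, E) m).symm y
  let A : E →L[ℝ] TangentSpace 𝓘(ℝ, E) x :=
    (trivializationAt E (TangentSpace 𝓘(ℝ, E)) m).symmL ℝ x
  (innerSL ℝ (E := TangentSpace 𝓘(ℝ, E) x)).bilinearComp A A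

/-- The Riemann curvature tensor `R(x, y, z, w) = ⟨R(x, y) w, z⟩` at `m`, computed in the
chart at `m`; `R(x, y, x, y)` is the sectional curvature when `x, y` are orthonormal. -/
def riemann (m : M) (x y z w : TangentSpace 𝓘(ℝ, E) m) : ℝ :=
  let A : TangentSpace 𝓘(ℝ, E) m →L[ℝ] E :=
    (trivializationAt E (TangentSpace 𝓘(ℝ, E)) m).continuousLinearMapAt ℝ m
  let G := metricInChart (E := E) m
  let a := extChartAt 𝓘(ℝ, E) m m
  G a (curvatureOperator G a (A x) (A y) (A w)) (A z)

variable [FiniteDimensional ℝ E]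

instance instFiniteDimensionalTangent (m : M) :
    FiniteDimensional ℝ (TangentSpace 𝓘(ℝ, E) m) :=
  inferInstanceAs (FiniteDimensional ℝ E)

variable (E)

/-- The Riemann curvature tensor at `m`, as a double form of bidegree `(2, 2)` on the tangent
space. -/
def riemannForm (m : M) : DoubleForms.DForm (TangentSpace 𝓘(ℝ, E) m) :=
  DoubleForms.ofTensor (riemann m)

/-- The `(p, q)`-curvature `s_{(p,q)}(P)` of a tangent `p`-plane `P` at `m`: the sectional curvature
of the `(p, q)`-curvature tensor. -/
def pqCurvature (p q : ℕ) (m : M) (P : Submodule ℝ (TangentSpace 𝓘(ℝ, E) m)) : ℝ :=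
  DoubleForms.sectional (DoubleForms.pqTensor (riemannForm E m) p q) P

end Manifold

end RiemannCurv

end

/-! Fix an `r`-plane `P`, with orthonormal bases `x` of `P` and `y` of `Pᗮ`. The full contraction
splits as `contr x + contr y`, two commuting operators, and a sectional curvature is the scalar part
of a power of a partial contraction: `p! K_ω(P) = aug (contr x ^ p ω)`. Contraction along `P`, the
product with `g` and a Cartan element satisfy relations of `sl₂` type, which yield `i! K_{g^k ω}(P)
= k! aug (contr x ^ i ω)` for `dim P = i + k`. If `ω ∈ D^{i,i}` is effective, then `contr y ω =
-contr x ω`; hence the curvatures of `g^l ω` at `Pᗮ` and of `g^k ω` at `P`, divided by `l!` and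
`k!`, differ by the sign `(-1)^i` (`sectional_orthogonal_metric_pow_mul`). Together with `K_{*η}(P)
= K_η(Pᗮ)` (`sectional_star`) this turns `s_{(r,q)}(P) + ε s_{(n-r,q)}(Pᗮ)` into the sectional
curvature at `P` of the single form `∑ bᵢ g^{r-i} ωᵢ`, where `bᵢ` is `curvatureCoeff`.

That curvature is constantly `λ` exactly when the form equals `(λ/r!) g^r`, because a double form
satisfying the first Bianchi identity is determined by its sectional curvatures
(`eq_zero_of_sectional_eq_zero`). Since `r + 2q ≤ n`, effective components are unique
(`eq_zero_of_sum_metric_pow_mul_eq_zero`), so this means `bᵢ ωᵢ = 0` for `i ≥ 1` and `r! b₀ ω₀ = λ`.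
The theorem then reduces to deciding which `bᵢ` vanish, which follows from the strict monotonicity
of `t ↦ (t+j)!/t!` for `j ≥ 1`.

The Bianchi identity is needed for each `ωᵢ`. The Bianchi operator commutes with `g`, with
contractions and with multiplication by `R`; so it kills `R^q`, and by uniqueness it kills each
component. For `R` itself the input is the cyclic identity (symmetry of the Christoffel symbols) and
skewness in the last two arguments (compatibility with the metric), both proved in a chart. -/

noncomputable section

namespace DoubleForms

open scoped InnerProductSpace

/-! ### Creation and annihilation operators on double forms -/

section Operators

variable {V : Type*} [NormedAddCommGroup V] [InnerProductSpace ℝ V]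

variable (V) in
/-- The interior product, as a linear map in the vector. -/
def interiorHom : V →ₗ[ℝ] Module.End ℝ (Form V) :=
  CliffordAlgebra.contractLeft (Q := (0 : QuadraticForm ℝ (Module.Dual ℝ V))) ∘ₗ
    Module.Dual.eval ℝ V

variable (V) in
/-- The exterior product with `⟨v, ·⟩`, as a linear map in `v`. -/
def wedgeHom : V →ₗ[ℝ] Module.End ℝ (Form V) :=
  LinearMap.mul ℝ (Form V) ∘ₗ ExteriorAlgebra.ι ℝ ∘ₗ innerₗ V

theorem interiorHom_apply (v : V) : interiorHom V v = interior v := rfl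

theorem interior_ι_mul (u : V) (θ : Module.Dual ℝ V) (α : Form V) :
    interior u (ExteriorAlgebra.ι ℝ θ * α) = θ u • α - ExteriorAlgebra.ι ℝ θ * interior u α :=
  CliffordAlgebra.contractLeft_ι_mul (Q := (0 : QuadraticForm ℝ (Module.Dual ℝ V)))
    (d := Module.Dual.eval ℝ V u) θ α

theorem interior_flat_mul (u v : V) (α : Form V) :
    interior u (flat v * α) = ⟪v, u⟫_ℝ • α - flat v * interior u α := by
  rw [flat, interior_ι_mul]; rfl

theorem interior_interior_comm (u v : V) (α : Form V) :
    interior u (interior v α) = -interior v (interior u α) := 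
  CliffordAlgebra.contractLeft_comm (Q := (0 : QuadraticForm ℝ (Module.Dual ℝ V)))
    (Module.Dual.eval ℝ V u) (Module.Dual.eval ℝ V v) α

theorem interior_interior_self (u : V) (α : Form V) : interior u (interior u α) = 0 := 
  CliffordAlgebra.contractLeft_contractLeft (Q := (0 : QuadraticForm ℝ (Module.Dual ℝ V)))
    (Module.Dual.eval ℝ V u) α

theorem interior_algebraMap (u : V) (a : ℝ) : interior u (algebraMap ℝ (Form V) a) = 0 := 
  CliffordAlgebra.contractLeft_algebraMap (Q := (0 : QuadraticForm ℝ (Module.Dual ℝ V)))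
    (Module.Dual.eval ℝ V u) a

theorem flat_mul_flat_comm (u v : V) : flat u * flat v = -(flat v * flat u) :=
  eq_neg_of_add_eq_zero_left (ExteriorAlgebra.ι_add_mul_swap _ _)

variable (V) in
/-- Interior product on the left factor. -/
def iL : V →ₗ[ℝ] Module.End ℝ (DForm V) := LinearMap.rTensorHom (Form V) ∘ₗ interiorHom V

variable (V) in
/-- Interior product on the right factor. -/
def iR : V →ₗ[ℝ] Module.End ℝ (DForm V) := LinearMap.lTensorHom (Form V) ∘ₗ interiorHom V

variable (V) in
/-- Exterior product on the left factor. -/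
def eL : V →ₗ[ℝ] Module.End ℝ (DForm V) := LinearMap.rTensorHom (Form V) ∘ₗ wedgeHom V

variable (V) in
/-- Exterior product on the right factor. -/
def eR : V →ₗ[ℝ] Module.End ℝ (DForm V) := LinearMap.lTensorHom (Form V) ∘ₗ wedgeHom V

theorem iL_tmul (v : V) (α β : Form V) : iL V v (α ⊗ₜ β) = interior v α ⊗ₜ β := rfl

theorem iR_tmul (v : V) (α β : Form V) : iR V v (α ⊗ₜ β) = α ⊗ₜ interior v β := rfl

theorem eL_tmul (v : V) (α β : Form V) : eL V v (α ⊗ₜ β) = (flat v * α) ⊗ₜ β := rfl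

theorem eR_tmul (v : V) (α β : Form V) : eR V v (α ⊗ₜ β) = α ⊗ₜ (flat v * β) := rfl

/-- Two linear maps on double forms agree as soon as they agree on decomposable ones. -/
theorem apply_eq_of_tmul {W : Type*} [AddCommGroup W] [Module ℝ W] {f g : DForm V →ₗ[ℝ] W}
    (h : ∀ α β : Form V, f (α ⊗ₜ β) = g (α ⊗ₜ β)) (η : DForm V) : f η = g η :=
  LinearMap.congr_fun (TensorProduct.ext' h) η

theorem iL_eL (u v : V) (η : DForm V) :
    iL V u (eL V v η) = ⟪v, u⟫_ℝ • η - eL V v (iL V u η) := by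
  refine apply_eq_of_tmul (f := iL V u ∘ₗ eL V v)
    (g := ⟪v, u⟫_ℝ • LinearMap.id - eL V v ∘ₗ iL V u) (fun α β => ?_) η
  simp [iL_tmul, eL_tmul, interior_flat_mul, sub_tmul, smul_tmul']

theorem iR_eR (u v : V) (η : DForm V) :
    iR V u (eR V v η) = ⟪v, u⟫_ℝ • η - eR V v (iR V u η) := by
  refine apply_eq_of_tmul (f := iR V u ∘ₗ eR V v)
    (g := ⟪v, u⟫_ℝ • LinearMap.id - eR V v ∘ₗ iR V u) (fun α β => ?_) η
  simp [iR_tmul, eR_tmul, interior_flat_mul, tmul_sub]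

theorem iL_iL (u v : V) (η : DForm V) : iL V u (iL V v η) = -iL V v (iL V u η) := by
  refine apply_eq_of_tmul (f := iL V u ∘ₗ iL V v) (g := -(iL V v ∘ₗ iL V u)) (fun α β => ?_) η
  simp [iL_tmul, interior_interior_comm u v, neg_tmul]

theorem iR_iR (u v : V) (η : DForm V) : iR V u (iR V v η) = -iR V v (iR V u η) := by
  refine apply_eq_of_tmul (f := iR V u ∘ₗ iR V v) (g := -(iR V v ∘ₗ iR V u)) (fun α β => ?_) η
  simp [iR_tmul, interior_interior_comm u v, tmul_neg]

theorem eL_eL (u v : V) (η : DForm V) : eL V u (eL V v η) = -eL V v (eL V u η) := by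
  refine apply_eq_of_tmul (f := eL V u ∘ₗ eL V v) (g := -(eL V v ∘ₗ eL V u)) (fun α β => ?_) η
  simp [eL_tmul, ← mul_assoc, flat_mul_flat_comm u v, neg_tmul]

theorem eR_eR (u v : V) (η : DForm V) : eR V u (eR V v η) = -eR V v (eR V u η) := by
  refine apply_eq_of_tmul (f := eR V u ∘ₗ eR V v) (g := -(eR V v ∘ₗ eR V u)) (fun α β => ?_) η
  simp [eR_tmul, ← mul_assoc, flat_mul_flat_comm u v, tmul_neg]

theorem eq_zero_of_eq_neg {η : DForm V} (h : η = -η) : η = 0 := by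
  have h2 : (2 : ℝ) • η = 0 := by
    rw [two_smul]; nth_rewrite 1 [h]; exact neg_add_cancel η
  exact (smul_eq_zero.mp h2).resolve_left two_ne_zero

theorem iL_self (u : V) (η : DForm V) : iL V u (iL V u η) = 0 :=
  eq_zero_of_eq_neg (iL_iL u u η)

theorem iR_self (u : V) (η : DForm V) : iR V u (iR V u η) = 0 :=
  eq_zero_of_eq_neg (iR_iR u u η)

theorem eL_self (u : V) (η : DForm V) : eL V u (eL V u η) = 0 :=
  eq_zero_of_eq_neg (eL_eL u u η)

theorem iR_iL (u v : V) (η : DForm V) : iR V u (iL V v η) = iL V v (iR V u η) :=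
  apply_eq_of_tmul (f := iR V u ∘ₗ iL V v) (g := iL V v ∘ₗ iR V u) (fun _ _ => rfl) η

theorem iR_eL (u v : V) (η : DForm V) : iR V u (eL V v η) = eL V v (iR V u η) :=
  apply_eq_of_tmul (f := iR V u ∘ₗ eL V v) (g := eL V v ∘ₗ iR V u) (fun _ _ => rfl) η

theorem iL_eR (u v : V) (η : DForm V) : iL V u (eR V v η) = eR V v (iL V u η) :=
  apply_eq_of_tmul (f := iL V u ∘ₗ eR V v) (g := eR V v ∘ₗ iL V u) (fun _ _ => rfl) η

theorem eR_eL (u v : V) (η : DForm V) : eR V u (eL V v η) = eL V v (eR V u η) :=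
  apply_eq_of_tmul (f := eR V u ∘ₗ eL V v) (g := eL V v ∘ₗ eR V u) (fun _ _ => rfl) η

theorem flat_tmul_flat_mul (u v : V) (η : DForm V) :
    (flat u ⊗ₜ[ℝ] flat v : DForm V) * η = eL V u (eR V v η) :=
  apply_eq_of_tmul (f := LinearMap.mulLeft ℝ (flat u ⊗ₜ[ℝ] flat v : DForm V))
    (g := eL V u ∘ₗ eR V v)
    (fun α β => by simp [eL_tmul, eR_tmul, Algebra.TensorProduct.tmul_mul_tmul]) η

/-! Quadratic expressions in these operators, attached to a finite family of vectors. -/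

variable {ι κ : Type*} [Fintype ι] [Fintype κ]

/-- The contraction over a finite family of vectors. -/
def contr (x : ι → V) : Module.End ℝ (DForm V) := ∑ i, iL V (x i) * iR V (x i)

/-- The product with `∑ ⟨xᵢ, ·⟩ ⊗ ⟨xᵢ, ·⟩`. -/
def wedgeMetric (x : ι → V) : Module.End ℝ (DForm V) := ∑ i, eL V (x i) * eR V (x i)

/-- The degree operator of the left factor along a family of vectors. -/
def eulerL (x : ι → V) : Module.End ℝ (DForm V) := ∑ i, eL V (x i) * iL V (x i)

/-- The degree operator of the right factor along a family of vectors. -/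
def eulerR (x : ι → V) : Module.End ℝ (DForm V) := ∑ i, eR V (x i) * iR V (x i)

/-- The Bianchi operator `D^{p,q} → D^{p+1,q-1}` along a family of vectors. -/
def bianchi (x : ι → V) : Module.End ℝ (DForm V) := ∑ i, eL V (x i) * iR V (x i)

theorem contr_apply (x : ι → V) (η : DForm V) :
    contr x η = ∑ i, iL V (x i) (iR V (x i) η) := by simp [contr]

theorem wedgeMetric_apply (x : ι → V) (η : DForm V) :
    wedgeMetric x η = ∑ i, eL V (x i) (eR V (x i) η) := by simp [wedgeMetric]

theorem eulerL_apply (x : ι → V) (η : DForm V) :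
    eulerL x η = ∑ i, eL V (x i) (iL V (x i) η) := by simp [eulerL]

theorem eulerR_apply (x : ι → V) (η : DForm V) :
    eulerR x η = ∑ i, eR V (x i) (iR V (x i) η) := by simp [eulerR]

theorem bianchi_apply (x : ι → V) (η : DForm V) :
    bianchi x η = ∑ i, eL V (x i) (iR V (x i) η) := by simp [bianchi]

/-- The combination `∑ ⟨wₖ, u⟩ wₖ`; for an orthonormal family `w` this is the orthogonal projection
of `u` to the span of `w`. -/
def proj (w : κ → V) (u : V) : V := ∑ k, ⟪w k, u⟫_ℝ • w k

/-- The trace of a bilinear map over a Parseval frame does not depend on the frame. -/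
theorem sum_parsevalFrame_eq {W : Type*} [AddCommGroup W] [Module ℝ W]
    {x : ι → V} {y : κ → V} (hx : ∀ u, proj x u = u) (hy : ∀ u, proj y u = u)
    (B : V →ₗ[ℝ] V →ₗ[ℝ] W) : ∑ i, B (x i) (x i) = ∑ j, B (y j) (y j) := by
  calc ∑ i, B (x i) (x i) = ∑ i, B (proj y (x i)) (x i) := by simp only [hy]
    _ = ∑ j, B (y j) (proj x (y j)) := by
        simp only [proj, map_sum, map_smul, LinearMap.sum_apply, LinearMap.smul_apply]
        rw [Finset.sum_comm]
        simp only [real_inner_comm]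
    _ = ∑ j, B (y j) (y j) := by simp only [hx]

/-- This freedom allows the standard basis to be replaced by one adapted to a plane and its
orthogonal complement. -/
theorem contr_eq {x : ι → V} {y : κ → V} (hx : ∀ u, proj x u = u)
    (hy : ∀ u, proj y u = u) : contr x = contr y :=
  sum_parsevalFrame_eq hx hy ((LinearMap.mul ℝ _).compl₁₂ (iL V) (iR V))

end Operators

section Euclidean

variable {V : Type*} [NormedAddCommGroup V] [InnerProductSpace ℝ V] [FiniteDimensional ℝ V]

theorem metric_mul (η : DForm V) :
    metric V * η = wedgeMetric (stdOrthonormalBasis ℝ V : _ → V) η := by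
  simp [metric, Finset.sum_mul, flat_tmul_flat_mul, wedgeMetric_apply]

theorem contraction_eq :
    (contraction : DForm V →ₗ[ℝ] DForm V) = contr (stdOrthonormalBasis ℝ V : _ → V) := by
  unfold contraction contr
  refine Finset.sum_congr rfl fun i _ => TensorProduct.ext' fun α β => rfl

end Euclidean

end DoubleForms

end

noncomputable section

namespace DoubleForms

open scoped InnerProductSpace

/-! ### Commutation relations of contraction, metric product and degree operators -/

section Commutation

variable {V : Type*} [NormedAddCommGroup V] [InnerProductSpace ℝ V]
variable {ι κ : Type*} [Fintype ι] [Fintype κ]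

theorem proj_orthonormalBasis (b : OrthonormalBasis κ ℝ V) (u : V) : proj b u = u :=
  b.sum_repr' u

theorem proj_orthonormal {w : κ → V} (hw : Orthonormal ℝ w) (i : κ) : proj w (w i) = w i := by
  classical
  simp [proj, orthonormal_iff_ite.mp hw]

theorem proj_eq_zero {w : κ → V} {u : V} (h : ∀ k, ⟪w k, u⟫_ℝ = 0) : proj w u = 0 := by
  simp [proj, h]

theorem inner_proj_self (w : κ → V) (u : V) : ⟪proj w u, u⟫_ℝ = ∑ k, ⟪w k, u⟫_ℝ * ⟪w k, u⟫_ℝ := by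
  simp [proj, sum_inner, inner_smul_left]

theorem map_proj {W : Type*} [AddCommGroup W] [Module ℝ W] (f : V →ₗ[ℝ] Module.End ℝ W)
    (w : κ → V) (u : V) (η : W) : ∑ k, ⟪w k, u⟫_ℝ • f (w k) η = f (proj w u) η := by
  simp [proj]

/-- The correction involves only `proj w u`. It is a full degree shift when `w` is orthonormal and
`u` belongs to it, and disappears when `u` is orthogonal to `w`; both cases are used below, for the
operators of one plane and for those of complementary planes. -/
theorem eulerL_iL (w : κ → V) (u : V) (η : DForm V) :
    eulerL w (iL V u η) = iL V u (eulerL w η) - iL V (proj w u) η := by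
  simp only [eulerL_apply, ← map_proj, map_sum, iL_eL, iL_iL _ u, map_neg, ← Finset.sum_sub_distrib]
  exact Finset.sum_congr rfl fun k _ => by abel

theorem eulerR_iR (w : κ → V) (u : V) (η : DForm V) :
    eulerR w (iR V u η) = iR V u (eulerR w η) - iR V (proj w u) η := by
  simp only [eulerR_apply, ← map_proj, map_sum, iR_eR, iR_iR _ u, map_neg, ← Finset.sum_sub_distrib]
  exact Finset.sum_congr rfl fun k _ => by abel

theorem eulerL_iR (w : κ → V) (u : V) (η : DForm V) :
    eulerL w (iR V u η) = iR V u (eulerL w η) := by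
  simp only [eulerL_apply, map_sum, iR_eL, iR_iL]

theorem eulerR_iL (w : κ → V) (u : V) (η : DForm V) :
    eulerR w (iL V u η) = iL V u (eulerR w η) := by
  simp only [eulerR_apply, map_sum, iL_eR, iR_iL]

theorem eulerL_eL (w : κ → V) (u : V) (η : DForm V) :
    eulerL w (eL V u η) = eL V u (eulerL w η) + eL V (proj w u) η := by
  simp only [eulerL_apply, ← map_proj, map_sum, iL_eL, eL_eL u, map_sub, map_smul,
    ← Finset.sum_add_distrib]
  exact Finset.sum_congr rfl fun k _ => by rw [real_inner_comm]; abel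

theorem eulerR_eR (w : κ → V) (u : V) (η : DForm V) :
    eulerR w (eR V u η) = eR V u (eulerR w η) + eR V (proj w u) η := by
  simp only [eulerR_apply, ← map_proj, map_sum, iR_eR, eR_eR u, map_sub, map_smul,
    ← Finset.sum_add_distrib]
  exact Finset.sum_congr rfl fun k _ => by rw [real_inner_comm]; abel

theorem eulerL_eR (w : κ → V) (u : V) (η : DForm V) :
    eulerL w (eR V u η) = eR V u (eulerL w η) := by
  simp only [eulerL_apply, map_sum, iL_eR, eR_eL]

theorem eulerR_eL (w : κ → V) (u : V) (η : DForm V) :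
    eulerR w (eL V u η) = eL V u (eulerR w η) := by
  simp only [eulerR_apply, map_sum, iR_eL, eR_eL]

/-- The Cartan element of the `sl₂`-triple attached to a finite family of vectors. -/
def cartan (x : ι → V) : Module.End ℝ (DForm V) :=
  (Fintype.card ι : ℝ) • LinearMap.id - eulerL x - eulerR x

theorem cartan_apply (x : ι → V) (η : DForm V) :
    cartan x η = (Fintype.card ι : ℝ) • η - eulerL x η - eulerR x η := by simp [cartan]

/-- Two families are allowed because the contraction along a plane must be commuted both with the
metric of that plane (`w = x`) and with the metric of all of `V` (`w` an orthonormal basis). The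
commutator sees only the family `x`. -/
theorem contr_wedgeMetric {x : ι → V} {w : κ → V} (hx : ∀ i, ⟪x i, x i⟫_ℝ = 1)
    (hw : ∀ i, proj w (x i) = x i) (η : DForm V) :
    contr x (wedgeMetric w η) = wedgeMetric w (contr x η) + cartan x η := by
  have key : ∀ i, iL V (x i) (iR V (x i) (wedgeMetric w η)) =
      wedgeMetric w (iL V (x i) (iR V (x i) η)) +
        (η - eL V (x i) (iL V (x i) η) - eR V (x i) (iR V (x i) η)) := by
    intro i
    have h1 : ∑ k, ⟪w k, x i⟫_ℝ * ⟪w k, x i⟫_ℝ = 1 := by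
      rw [← inner_proj_self, hw, hx]
    have h2 : ∑ k, ⟪w k, x i⟫_ℝ • eL V (w k) (iL V (x i) η) = eL V (x i) (iL V (x i) η) := by
      rw [map_proj, hw]
    have h3 : ∑ k, ⟪w k, x i⟫_ℝ • eR V (w k) (iR V (x i) η) = eR V (x i) (iR V (x i) η) := by
      rw [map_proj, hw]
    rw [← h2, ← h3]
    have h0 : ∑ k, (⟪w k, x i⟫_ℝ * ⟪w k, x i⟫_ℝ) • η = η := by
      rw [← Finset.sum_smul, h1, one_smul]
    conv_rhs => enter [2, 1, 1]; rw [← h0]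
    simp only [wedgeMetric_apply, map_sum]
    rw [← Finset.sum_sub_distrib, ← Finset.sum_sub_distrib, ← Finset.sum_add_distrib]
    refine Finset.sum_congr rfl fun k _ => ?_
    simp only [iR_eL, iR_eR, map_sub, map_smul, iL_eL, iL_eR, smul_sub, smul_smul]
    abel
  rw [contr_apply, Finset.sum_congr rfl fun i _ => key i, Finset.sum_add_distrib,
    Finset.sum_sub_distrib, Finset.sum_sub_distrib, ← map_sum, ← contr_apply, ← eulerL_apply,
    ← eulerR_apply, cartan_apply]
  simp [Nat.cast_smul_eq_nsmul]

theorem contr_cartan {x : ι → V} (hx : Orthonormal ℝ x) (η : DForm V) :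
    contr x (cartan x η) = cartan x (contr x η) - (2 : ℝ) • contr x η := by
  rw [two_smul]
  simp only [cartan_apply, contr_apply, map_sum, map_sub, map_smul, eulerL_iL, eulerR_iR,
    eulerL_iR, eulerR_iL, proj_orthonormal hx, Finset.sum_sub_distrib, Finset.smul_sum]
  abel

theorem cartan_wedgeMetric {b : κ → V} {w : ι → V} (hw : ∀ i, proj b (w i) = w i) (η : DForm V) :
    cartan b (wedgeMetric w η) = wedgeMetric w (cartan b η) - (2 : ℝ) • wedgeMetric w η := by
  rw [two_smul]
  simp only [cartan_apply, wedgeMetric_apply, map_sum, map_sub, map_smul, eulerL_eL, eulerR_eR,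
    eulerL_eR, eulerR_eL, hw, map_add, Finset.sum_sub_distrib, Finset.sum_add_distrib,
    Finset.smul_sum]
  abel

theorem contr_comm (x : ι → V) (y : κ → V) (η : DForm V) :
    contr x (contr y η) = contr y (contr x η) := by
  simp only [contr_apply, map_sum]
  rw [Finset.sum_comm]
  refine Finset.sum_congr rfl fun i _ => Finset.sum_congr rfl fun k _ => ?_
  rw [iR_iL, iR_iR, map_neg, map_neg, iL_iL, neg_neg, iR_iL]

theorem contr_wedgeMetric_comm {x : ι → V} {y : κ → V} (h : ∀ i k, ⟪y k, x i⟫_ℝ = 0)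
    (η : DForm V) : contr x (wedgeMetric y η) = wedgeMetric y (contr x η) := by
  simp only [contr_apply, wedgeMetric_apply, map_sum]
  rw [Finset.sum_comm]
  refine Finset.sum_congr rfl fun k _ => Finset.sum_congr rfl fun i _ => ?_
  simp [iR_eL, iR_eR, iL_eL, iL_eR, h]

theorem contr_cartan_comm {x : ι → V} {y : κ → V} (h : ∀ i k, ⟪y k, x i⟫_ℝ = 0)
    (η : DForm V) : contr x (cartan y η) = cartan y (contr x η) := by
  simp only [cartan_apply, contr_apply, map_sum, map_sub, map_smul, eulerL_iL, eulerR_iR,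
    eulerL_iR, eulerR_iL, proj_eq_zero (h _), map_zero, sub_zero, LinearMap.zero_apply,
    Finset.sum_sub_distrib, Finset.smul_sum]

/-- The scalar component of a double form. -/
def aug : DForm V →ₗ[ℝ] ℝ :=
  LinearMap.mul' ℝ ℝ ∘ₗ TensorProduct.map ExteriorAlgebra.algebraMapInv.toLinearMap
    ExteriorAlgebra.algebraMapInv.toLinearMap

theorem algebraMapInv_flat_mul (u : V) (α : Form V) :
    ExteriorAlgebra.algebraMapInv (flat u * α) = 0 := by
  simp [flat, ExteriorAlgebra.algebraMapInv]

theorem aug_tmul (α β : Form V) : aug (α ⊗ₜ[ℝ] β : DForm V) =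
    ExteriorAlgebra.algebraMapInv α * ExteriorAlgebra.algebraMapInv β := rfl

theorem aug_eL (u : V) (η : DForm V) : aug (eL V u η) = 0 :=
  apply_eq_of_tmul (f := aug ∘ₗ eL V u) (g := 0)
    (fun α β => by simp [eL_tmul, aug_tmul, algebraMapInv_flat_mul]) η

theorem aug_eR (u : V) (η : DForm V) : aug (eR V u η) = 0 :=
  apply_eq_of_tmul (f := aug ∘ₗ eR V u) (g := 0)
    (fun α β => by simp [eR_tmul, aug_tmul, algebraMapInv_flat_mul]) η

theorem aug_wedgeMetric (x : ι → V) (η : DForm V) : aug (wedgeMetric x η) = 0 := by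
  simp [wedgeMetric_apply, aug_eL]

theorem aug_cartan (x : ι → V) (η : DForm V) :
    aug (cartan x η) = Fintype.card ι * aug η := by
  simp [cartan_apply, eulerL_apply, eulerR_apply, aug_eL, aug_eR]

end Commutation

/-! ### Representations of `sl₂` -/

section SlTwo

variable {W : Type*} [AddCommGroup W] [Module ℝ W] {c g h : Module.End ℝ W}

/-- Each of the `m + 1` lowerings passed through `g` leaves one `h`, and moving `h` to the left of
the remaining powers of `c` costs `2` each time; these costs add up to `m (m + 1)`. -/
theorem lower_pow_raise (hcg : ∀ η, c (g η) = g (c η) + h η)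
    (hch : ∀ η, c (h η) = h (c η) - (2 : ℝ) • c η) (m : ℕ) (η : W) :
    (c ^ (m + 1)) (g η) = g ((c ^ (m + 1)) η) + (m + 1 : ℝ) • (h ((c ^ m) η) - (m : ℝ) • (c ^ m) η) := by
  induction m with
  | zero => simp [hcg]
  | succ m ih =>
    rw [pow_succ', Module.End.mul_apply, ih]
    simp only [map_add, map_smul, map_sub, hcg, hch, pow_succ' c, Module.End.mul_apply]
    push_cast
    module

/-- A functional that kills the image of `g` and sees `h` as the scalar `p` gives `ψ (c^(N+1) (g ζ))
= (N+1)(p-N) ψ (c^N ζ)`. Iterating produces the two factorial quotients. -/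
theorem functional_lower_pow_raise_pow (hcg : ∀ η, c (g η) = g (c η) + h η)
    (hch : ∀ η, c (h η) = h (c η) - (2 : ℝ) • c η) {ψ : W →ₗ[ℝ] ℝ} (hg : ∀ η, ψ (g η) = 0)
    {p : ℕ} (hh : ∀ η, ψ (h η) = p * ψ η) (m k j : ℕ) (hp : p = m + k + j) (η : W) :
    (m ! : ℝ) * j ! * ψ ((c ^ (m + k)) ((g ^ k) η)) = (m + k)! * (k + j)! * ψ ((c ^ m) η) := by
  induction k generalizing j with
  | zero => simp
  | succ k ih =>
    have := ih (j + 1) (by omega)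
    rw [pow_succ' g, Module.End.mul_apply, ← add_assoc, lower_pow_raise hcg hch, map_add, hg,
      map_smul, map_sub, map_smul, hh, hp, smul_eq_mul, smul_eq_mul]
    rw [Nat.factorial_succ j] at this
    rw [Nat.factorial_succ (m + k), show k + 1 + j = k + (j + 1) by ring]
    push_cast at this ⊢
    linear_combination (m + k + 1 : ℝ) * this

theorem weight_raise_pow (hhg : ∀ η, h (g η) = g (h η) - (2 : ℝ) • g η) {μ : ℝ} {ζ : W}
    (hz : h ζ = μ • ζ) (k : ℕ) : h ((g ^ k) ζ) = (μ - 2 * k) • (g ^ k) ζ := by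
  induction k with
  | zero => simp [hz]
  | succ k ih =>
    rw [pow_succ', Module.End.mul_apply, hhg, ih, map_smul]
    push_cast
    module

/-- The usual computation on a string generated by a vector killed by `c`: the weights `μ, μ - 2, …,
μ - 2k` sum to the stated factor. -/
theorem lower_raise_pow (hcg : ∀ η, c (g η) = g (c η) + h η)
    (hhg : ∀ η, h (g η) = g (h η) - (2 : ℝ) • g η) {μ : ℝ} {ζ : W} (hc : c ζ = 0)
    (hz : h ζ = μ • ζ) (k : ℕ) :
    c ((g ^ (k + 1)) ζ) = ((k + 1) * (μ - k)) • (g ^ k) ζ := by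
  induction k with
  | zero => simp [hcg, hc, hz]
  | succ k ih =>
    rw [pow_succ', Module.End.mul_apply, hcg, ih, weight_raise_pow hhg hz, map_smul, pow_succ' g k,
      Module.End.mul_apply]
    push_cast
    module

end SlTwo

/-! ### Powers of sums of commuting square-zero elements -/

section NilpotentSum

variable {A : Type*} [Ring A]

theorem add_pow_succ_of_sq_eq_zero {a b : A} (hab : Commute a b) (ha : a * a = 0) (n : ℕ) :
    (a + b) ^ (n + 1) = b ^ (n + 1) + (n + 1) • (b ^ n * a) := by
  induction n with
  | zero => simp [add_comm]
  | succ n ih =>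
    have h1 : b ^ (n + 1) * a = b ^ n * a * b := by rw [pow_succ, mul_assoc, mul_assoc, hab.eq]
    have h2 : b ^ n * a * a = 0 := by rw [mul_assoc, ha, mul_zero]
    rw [pow_succ, ih, add_mul, mul_add, smul_mul_assoc, mul_add, h2, zero_add, ← h1,
      ← pow_succ b (n + 1), succ_nsmul _ (n + 1)]
    abel

/-- Only square-free monomials survive the multinomial expansion: in degree `p` there is one, with
coefficient `p!`, and in degree `p + 1` there is none. -/
theorem sum_pow_of_sq_eq_zero {p : ℕ} (f : Fin p → A) (hf : ∀ i j, Commute (f i) (f j))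
    (h0 : ∀ i, f i * f i = 0) :
    (∑ i, f i) ^ p = p ! • (List.ofFn f).reverse.prod ∧ (∑ i, f i) ^ (p + 1) = 0 := by
  induction p with
  | zero => simp
  | succ p ih =>
    obtain ⟨h1, h2⟩ := ih (fun i => f i.succ) (fun _ _ => hf _ _) (fun _ => h0 _)
    have hc : Commute (f 0) (∑ i : Fin p, f i.succ) :=
      Commute.sum_right _ _ _ fun i _ => hf _ _
    rw [Fin.sum_univ_succ, add_pow_succ_of_sq_eq_zero hc (h0 0),
      add_pow_succ_of_sq_eq_zero hc (h0 0), pow_succ _ (p + 1), h2, h1]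
    constructor
    · rw [List.ofFn_succ, List.reverse_cons, List.prod_append, List.prod_singleton,
        Nat.factorial_succ, smul_mul_assoc, zero_add, smul_smul]
    · simp

theorem ofFn_reverse_prod {p : ℕ} (f : Fin p → A) (hf : ∀ i j, Commute (f i) (f j)) :
    (List.ofFn f).reverse.prod = (List.ofFn f).prod := by
  refine (List.reverse_perm _).prod_eq' ?_
  rw [List.pairwise_reverse, List.pairwise_ofFn]
  exact fun i j _ => (hf j i)

end NilpotentSum

end DoubleForms

end

noncomputable section

namespace DoubleForms

open scoped InnerProductSpace

/-! ### Degrees -/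

section Degree

variable {V : Type*} [NormedAddCommGroup V] [InnerProductSpace ℝ V]

theorem algebraMap_mem_exteriorPower_zero (a : ℝ) :
    algebraMap ℝ (Form V) a ∈ ⋀[ℝ]^0 (Module.Dual ℝ V) := by
  rw [ExteriorAlgebra.exteriorPower, pow_zero]
  exact Submodule.algebraMap_mem a

theorem exists_of_mem_exteriorPower_zero {α : Form V} (h : α ∈ ⋀[ℝ]^0 (Module.Dual ℝ V)) :
    ∃ a : ℝ, algebraMap ℝ (Form V) a = α := by
  rwa [ExteriorAlgebra.exteriorPower, pow_zero, Submodule.mem_one] at h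

theorem ι_mul_mem_exteriorPower (θ : Module.Dual ℝ V) {p : ℕ} {α : Form V}
    (h : α ∈ ⋀[ℝ]^p (Module.Dual ℝ V)) :
    ExteriorAlgebra.ι ℝ θ * α ∈ ⋀[ℝ]^(p + 1) (Module.Dual ℝ V) := by
  rw [ExteriorAlgebra.exteriorPower, pow_succ']
  exact Submodule.mul_mem_mul (LinearMap.mem_range_self _ _) h

theorem flat_mul_mem_exteriorPower (u : V) {p : ℕ} {α : Form V}
    (h : α ∈ ⋀[ℝ]^p (Module.Dual ℝ V)) : flat u * α ∈ ⋀[ℝ]^(p + 1) (Module.Dual ℝ V) :=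
  ι_mul_mem_exteriorPower _ h

theorem mul_mem_exteriorPower {p q : ℕ} {α β : Form V} (hα : α ∈ ⋀[ℝ]^p (Module.Dual ℝ V))
    (hβ : β ∈ ⋀[ℝ]^q (Module.Dual ℝ V)) : α * β ∈ ⋀[ℝ]^(p + q) (Module.Dual ℝ V) := by
  rw [ExteriorAlgebra.exteriorPower, pow_add]
  exact Submodule.mul_mem_mul hα hβ

@[elab_as_elim]
theorem exteriorPower_succ_induction {p : ℕ} {P : Form V → Prop}
    (mul : ∀ θ, ∀ α ∈ ⋀[ℝ]^p (Module.Dual ℝ V), P (ExteriorAlgebra.ι ℝ θ * α))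
    (add : ∀ α β, P α → P β → P (α + β)) {α : Form V} (h : α ∈ ⋀[ℝ]^(p + 1) (Module.Dual ℝ V)) :
    P α := by
  rw [ExteriorAlgebra.exteriorPower, pow_succ'] at h
  refine Submodule.mul_induction_on h ?_ add
  rintro _ ⟨θ, rfl⟩ β hβ
  exact mul θ β hβ

theorem interior_mem_exteriorPower (u : V) {p : ℕ} {α : Form V}
    (h : α ∈ ⋀[ℝ]^(p + 1) (Module.Dual ℝ V)) : interior u α ∈ ⋀[ℝ]^p (Module.Dual ℝ V) := by
  induction p generalizing α with
  | zero =>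
    refine exteriorPower_succ_induction (fun θ β hβ => ?_) (fun α β hα hβ => ?_) h
    · obtain ⟨a, rfl⟩ := exists_of_mem_exteriorPower_zero hβ
      rw [interior_ι_mul, interior_algebraMap, mul_zero, sub_zero]
      exact Submodule.smul_mem _ _ (algebraMap_mem_exteriorPower_zero a)
    · rw [map_add]; exact add_mem hα hβ
  | succ p ih =>
    refine exteriorPower_succ_induction (fun θ β hβ => ?_) (fun α β hα hβ => ?_) h
    · rw [interior_ι_mul]
      exact sub_mem (Submodule.smul_mem _ _ hβ) (ι_mul_mem_exteriorPower _ (ih hβ))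
    · rw [map_add]; exact add_mem hα hβ

theorem tmul_mem_bidegree {p q : ℕ} {α β : Form V} (hα : α ∈ ⋀[ℝ]^p (Module.Dual ℝ V))
    (hβ : β ∈ ⋀[ℝ]^q (Module.Dual ℝ V)) : α ⊗ₜ[ℝ] β ∈ bidegree V p q :=
  ⟨⟨α, hα⟩ ⊗ₜ ⟨β, hβ⟩, rfl⟩

@[elab_as_elim]
theorem bidegree_induction {p q : ℕ} {P : DForm V → Prop} (zero : P 0)
    (tmul : ∀ α ∈ ⋀[ℝ]^p (Module.Dual ℝ V), ∀ β ∈ ⋀[ℝ]^q (Module.Dual ℝ V), P (α ⊗ₜ β))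
    (add : ∀ η ζ, P η → P ζ → P (η + ζ)) {η : DForm V} (h : η ∈ bidegree V p q) : P η := by
  obtain ⟨t, rfl⟩ := h
  induction t using TensorProduct.induction_on with
  | zero => simpa using zero
  | tmul a b => exact tmul a a.2 b b.2
  | add s t hs ht => rw [map_add]; exact add _ _ hs ht

/-- A linear map sends a bidegree to a submodule as soon as decomposable elements are sent there. -/
theorem map_mem_of_bidegree {p q : ℕ} {W : Type*} [AddCommGroup W] [Module ℝ W]
    (f : DForm V →ₗ[ℝ] W) (N : Submodule ℝ W)
    (tmul : ∀ α ∈ ⋀[ℝ]^p (Module.Dual ℝ V), ∀ β ∈ ⋀[ℝ]^q (Module.Dual ℝ V), f (α ⊗ₜ β) ∈ N)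
    {η : DForm V} (h : η ∈ bidegree V p q) : f η ∈ N :=
  bidegree_induction (by simp) tmul (fun η ζ h₁ h₂ => by rw [map_add]; exact add_mem h₁ h₂) h

theorem iL_mem {p q : ℕ} (u : V) {η : DForm V} (h : η ∈ bidegree V (p + 1) q) :
    iL V u η ∈ bidegree V p q :=
  map_mem_of_bidegree _ _ (fun _ hα _ hβ =>
    tmul_mem_bidegree (interior_mem_exteriorPower u hα) hβ) h

theorem iR_mem {p q : ℕ} (u : V) {η : DForm V} (h : η ∈ bidegree V p (q + 1)) :
    iR V u η ∈ bidegree V p q :=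
  map_mem_of_bidegree _ _ (fun _ hα _ hβ =>
    tmul_mem_bidegree hα (interior_mem_exteriorPower u hβ)) h

theorem mul_mem_bidegree {p q p' q' : ℕ} {η ζ : DForm V} (hη : η ∈ bidegree V p q)
    (hζ : ζ ∈ bidegree V p' q') : η * ζ ∈ bidegree V (p + p') (q + q') := by
  refine map_mem_of_bidegree (LinearMap.mulRight ℝ ζ) _ (fun α hα β hβ => ?_) hη
  refine map_mem_of_bidegree (LinearMap.mulLeft ℝ (α ⊗ₜ β : DForm V)) _ (fun γ hγ δ hδ => ?_) hζ
  rw [LinearMap.mulLeft_apply, Algebra.TensorProduct.tmul_mul_tmul]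
  exact tmul_mem_bidegree (mul_mem_exteriorPower hα hγ) (mul_mem_exteriorPower hβ hδ)

theorem algebraMap_mem_bidegree (a : ℝ) : algebraMap ℝ (DForm V) a ∈ bidegree V 0 0 := by
  rw [Algebra.TensorProduct.algebraMap_apply]
  exact tmul_mem_bidegree (algebraMap_mem_exteriorPower_zero a)
    (by rw [← map_one (algebraMap ℝ (Form V))]; exact algebraMap_mem_exteriorPower_zero 1)

theorem exists_of_mem_bidegree_zero {η : DForm V} (h : η ∈ bidegree V 0 0) :
    ∃ a : ℝ, algebraMap ℝ (DForm V) a = η := by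
  refine bidegree_induction ⟨0, map_zero _⟩ (fun α hα β hβ => ?_) ?_ h
  · obtain ⟨a, rfl⟩ := exists_of_mem_exteriorPower_zero hα
    obtain ⟨b, rfl⟩ := exists_of_mem_exteriorPower_zero hβ
    refine ⟨a * b, ?_⟩
    rw [map_mul, Algebra.TensorProduct.algebraMap_apply, Algebra.TensorProduct.algebraMap_apply',
      Algebra.TensorProduct.tmul_mul_tmul, mul_one, one_mul]
  · rintro _ _ ⟨a, rfl⟩ ⟨b, rfl⟩
    exact ⟨a + b, map_add _ _ _⟩

theorem pow_mem_bidegree {p : ℕ} {η : DForm V} (h : η ∈ bidegree V p p) (k : ℕ) :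
    η ^ k ∈ bidegree V (p * k) (p * k) := by
  induction k with
  | zero => rw [pow_zero, mul_zero, ← map_one (algebraMap ℝ (DForm V))]; exact algebraMap_mem_bidegree 1
  | succ k ih => rw [pow_succ, mul_add_one]; exact mul_mem_bidegree ih h

theorem aug_algebraMap (a : ℝ) : aug (algebraMap ℝ (DForm V) a) = a := by
  rw [Algebra.TensorProduct.algebraMap_apply, aug_tmul]
  simp

theorem algebraMap_dform_injective : Function.Injective (algebraMap ℝ (DForm V)) :=
  Function.LeftInverse.injective aug_algebraMap

variable {κ : Type*} [Fintype κ]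

/-- Euler's identity: a new factor `θ` is recovered once from `∑ θ(b k) b k`, and otherwise the
operators pass through it with two cancelling signs. -/
theorem sum_flat_mul_interior {b : κ → V} (hb : ∀ u, proj b u = u) {p : ℕ} {α : Form V}
    (h : α ∈ ⋀[ℝ]^p (Module.Dual ℝ V)) :
    ∑ k, flat (b k) * interior (b k) α = (p : ℝ) • α := by
  induction p generalizing α with
  | zero =>
    obtain ⟨a, rfl⟩ := exists_of_mem_exteriorPower_zero h
    simp [interior_algebraMap]
  | succ p ih =>
    refine exteriorPower_succ_induction (fun θ β hβ => ?_) (fun α β hα hβ => ?_) h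
    · have hθ : ∑ k, θ (b k) • flat (b k) = ExteriorAlgebra.ι ℝ θ := by
        simp only [flat, ← map_smul, ← map_sum]
        congr 1
        ext u
        conv_rhs => rw [← hb u]
        simp [proj, mul_comm]
      have hβ' := ih hβ
      simp only [interior_ι_mul, mul_sub, mul_smul_comm, ← smul_mul_assoc, Finset.sum_sub_distrib,
        ← Finset.sum_mul, hθ]
      have : ∀ k, flat (b k) * (ExteriorAlgebra.ι ℝ θ * interior (b k) β) =
          -(ExteriorAlgebra.ι ℝ θ * (flat (b k) * interior (b k) β)) := fun k => by
        rw [← mul_assoc, flat, eq_neg_of_add_eq_zero_left (ExteriorAlgebra.ι_add_mul_swap _ _),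
          neg_mul, mul_assoc]
      simp only [this, Finset.sum_neg_distrib, ← Finset.mul_sum, hβ']
      push_cast
      simp only [mul_smul_comm, smul_mul_assoc]
      module
    · simp only [map_add, mul_add, Finset.sum_add_distrib, hα, hβ, smul_add]

theorem eulerL_of_mem {b : κ → V} (hb : ∀ u, proj b u = u) {p q : ℕ} {η : DForm V}
    (h : η ∈ bidegree V p q) : eulerL b η = (p : ℝ) • η := by
  refine bidegree_induction (by simp) (fun α hα β hβ => ?_)
    (fun η ζ h₁ h₂ => by rw [map_add, h₁, h₂, smul_add]) h
  simp only [eulerL_apply, eL_tmul, iL_tmul, ← sum_tmul, sum_flat_mul_interior hb hα, smul_tmul']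

theorem eulerR_of_mem {b : κ → V} (hb : ∀ u, proj b u = u) {p q : ℕ} {η : DForm V}
    (h : η ∈ bidegree V p q) : eulerR b η = (q : ℝ) • η := by
  refine bidegree_induction (by simp) (fun α hα β hβ => ?_)
    (fun η ζ h₁ h₂ => by rw [map_add, h₁, h₂, smul_add]) h
  simp only [eulerR_apply, eR_tmul, iR_tmul, ← tmul_sum, sum_flat_mul_interior hb hβ, tmul_smul]

theorem cartan_of_mem {b : κ → V} (hb : ∀ u, proj b u = u) {p q : ℕ} {η : DForm V}
    (h : η ∈ bidegree V p q) : cartan b η = (Fintype.card κ - p - q : ℝ) • η := by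
  rw [cartan_apply, eulerL_of_mem hb h, eulerR_of_mem hb h]
  module

/-- Passing a one-form costs `(-1)^p` in each tensor factor, and the two signs cancel. -/
theorem commute_flat_tmul_flat {p : ℕ} {η : DForm V} (h : η ∈ bidegree V p p) (u v : V) :
    Commute η (flat u ⊗ₜ flat v) := by
  have key : ∀ (w : V) {p : ℕ} {α : Form V}, α ∈ ⋀[ℝ]^p (Module.Dual ℝ V) →
      α * flat w = (-1 : ℝ) ^ p • (flat w * α) := by
    intro w p
    induction p with
    | zero =>
      intro α hα
      obtain ⟨a, rfl⟩ := exists_of_mem_exteriorPower_zero hα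
      simpa using Algebra.commutes a (flat w)
    | succ p ih =>
      intro α hα
      refine exteriorPower_succ_induction (fun θ β hβ => ?_) (fun α β hα hβ => ?_) hα
      · rw [mul_assoc, ih hβ, mul_smul_comm, ← mul_assoc, ← mul_assoc, flat,
          eq_neg_of_add_eq_zero_left (ExteriorAlgebra.ι_add_mul_swap θ _), pow_succ]
        simp
      · rw [add_mul, hα, hβ, mul_add, smul_add]
  refine bidegree_induction (Commute.zero_left _) (fun α hα β hβ => ?_)
    (fun _ _ h₁ h₂ => h₁.add_left h₂) h
  rw [commute_iff_eq, Algebra.TensorProduct.tmul_mul_tmul, Algebra.TensorProduct.tmul_mul_tmul,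
    key u hα, key v hβ, smul_tmul_smul, ← pow_add, Even.neg_one_pow ⟨p, rfl⟩, one_smul]

end Degree

/-! ### The metric and the full contraction on forms of given bidegree -/

section MetricDegree

variable {V : Type*} [NormedAddCommGroup V] [InnerProductSpace ℝ V] [FiniteDimensional ℝ V]

theorem proj_stdOrthonormalBasis (u : V) : proj (stdOrthonormalBasis ℝ V : _ → V) u = u :=
  proj_orthonormalBasis _ u

theorem metric_pow_mul (k : ℕ) (η : DForm V) :
    metric V ^ k * η = (wedgeMetric (stdOrthonormalBasis ℝ V : _ → V) ^ k) η := by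
  induction k with
  | zero => simp
  | succ k ih => rw [pow_succ', mul_assoc, ih, metric_mul, pow_succ', Module.End.mul_apply]

theorem metric_mem : metric V ∈ bidegree V 1 1 := by
  have h : ∀ v : V, flat v ∈ ⋀[ℝ]^1 (Module.Dual ℝ V) := fun v => by
    simpa using flat_mul_mem_exteriorPower v (algebraMap_mem_exteriorPower_zero (V := V) 1)
  exact sum_mem fun i _ => tmul_mem_bidegree (h _) (h _)

theorem metric_pow_mul_mem {i k : ℕ} {η : DForm V} (h : η ∈ bidegree V i i) :
    metric V ^ k * η ∈ bidegree V (k + i) (k + i) := by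
  simpa using mul_mem_bidegree (pow_mem_bidegree metric_mem k) h

theorem contraction_mem {p q : ℕ} {η : DForm V} (h : η ∈ bidegree V (p + 1) (q + 1)) :
    contraction η ∈ bidegree V p q := by
  rw [contraction_eq, contr_apply]
  exact sum_mem fun i _ => iL_mem _ (iR_mem _ h)

theorem contraction_of_mem_zero {η : DForm V} (h : η ∈ bidegree V 0 0) : contraction η = 0 := by
  obtain ⟨a, rfl⟩ := exists_of_mem_bidegree_zero h
  rw [contraction_eq, contr_apply, Algebra.TensorProduct.algebraMap_apply]
  simp [iR_tmul, iL_tmul, interior_algebraMap]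

theorem contraction_metric_mul (η : DForm V) : contraction (metric V * η) =
    metric V * contraction η + cartan (stdOrthonormalBasis ℝ V : _ → V) η := by
  rw [metric_mul, metric_mul, contraction_eq]
  exact contr_wedgeMetric (fun i => by simp) (fun i => proj_stdOrthonormalBasis _) η

/-- The contraction of `g^{k+1} ω` for an effective `ω`. -/
theorem contraction_metric_pow_mul {μ : ℝ} {ζ : DForm V} (hc : contraction ζ = 0)
    (hζ : cartan (stdOrthonormalBasis ℝ V : _ → V) ζ = μ • ζ) (k : ℕ) :
    contraction (metric V ^ (k + 1) * ζ) = ((k + 1) * (μ - k)) • (metric V ^ k * ζ) := by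
  rw [metric_pow_mul, metric_pow_mul]
  refine lower_raise_pow (h := cartan (stdOrthonormalBasis ℝ V : _ → V)) (fun η => ?_)
    (fun η => ?_) hc hζ k
  · rw [← metric_mul, ← metric_mul, contraction_metric_mul]
  · exact cartan_wedgeMetric (fun i => proj_stdOrthonormalBasis _) η

theorem cartan_std_of_mem {p q : ℕ} {η : DForm V} (h : η ∈ bidegree V p q) :
    cartan (stdOrthonormalBasis ℝ V : _ → V) η = (finrank ℝ V - p - q : ℝ) • η := by
  simpa using cartan_of_mem proj_stdOrthonormalBasis h

end MetricDegree

end DoubleForms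

end

noncomputable section

namespace DoubleForms

open scoped InnerProductSpace

/-! ### Sectional curvature and the Hodge star -/

section Evaluation

variable {V : Type*} [NormedAddCommGroup V] [InnerProductSpace ℝ V]

theorem evalForm_zero (x : Fin 0 → V) (α : Form V) :
    evalForm x α = ExteriorAlgebra.algebraMapInv α := by
  simp [evalForm]

theorem evalForm_succ {p : ℕ} (x : Fin (p + 1) → V) (α : Form V) :
    evalForm x α = evalForm (fun i => x i.succ) (interior (x 0) α) := by
  simp [evalForm, List.ofFn_succ]

theorem evalDForm_tmul {p q : ℕ} (x : Fin p → V) (y : Fin q → V) (α β : Form V) :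
    evalDForm x y (α ⊗ₜ β) = evalForm x α * evalForm y β := rfl

theorem evalDForm_self_zero (x : Fin 0 → V) (η : DForm V) : evalDForm x x η = aug η :=
  apply_eq_of_tmul (fun α β => by rw [evalDForm_tmul, evalForm_zero, evalForm_zero, aug_tmul]) η

theorem evalDForm_self_succ {p : ℕ} (x : Fin (p + 1) → V) (η : DForm V) :
    evalDForm x x η = evalDForm (fun i => x i.succ) (fun i => x i.succ)
      (iL V (x 0) (iR V (x 0) η)) :=
  apply_eq_of_tmul (g := evalDForm (fun i => x i.succ) (fun i => x i.succ) ∘ₗ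
    iL V (x 0) ∘ₗ iR V (x 0)) (fun α β => by
      rw [evalDForm_tmul, evalForm_succ, evalForm_succ x]; rfl) η

theorem evalDForm_self {p : ℕ} (x : Fin p → V) (η : DForm V) :
    evalDForm x x η = aug ((List.ofFn fun i => iL V (x i) * iR V (x i)).reverse.prod η) := by
  induction p generalizing η with
  | zero => simp [evalDForm_self_zero]
  | succ p ih => simp [evalDForm_self_succ, ih, List.ofFn_succ]

theorem contr_pow {p : ℕ} (x : Fin p → V) :
    contr x ^ p = p ! • (List.ofFn fun i => iL V (x i) * iR V (x i)).reverse.prod ∧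
      contr x ^ (p + 1) = 0 := by
  refine sum_pow_of_sq_eq_zero _ (fun i j => ?_) (fun i => ?_)
  · refine LinearMap.ext fun η => ?_
    simp only [Module.End.mul_apply]
    rw [iR_iL, iR_iR, map_neg, map_neg, iL_iL, neg_neg, iR_iL]
  · refine LinearMap.ext fun η => ?_
    simp only [Module.End.mul_apply]
    rw [iR_iL, iL_self, LinearMap.zero_apply]

/-- The operators `iL (x i) * iR (x i)` commute and square to zero, so the `p`-th power of their sum
is `p!` times their product. This turns values on the diagonal into an algebraic expression in
`contr x`. -/
theorem factorial_mul_evalDForm_self {p : ℕ} (x : Fin p → V) (η : DForm V) :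
    (p ! : ℝ) * evalDForm x x η = aug ((contr x ^ p) η) := by
  rw [(contr_pow x).1, evalDForm_self]
  simp [← Nat.cast_smul_eq_nsmul ℝ]

theorem ofFn_flat_tmul_flat_prod {p : ℕ} (x : Fin p → V) (η : DForm V) :
    (p ! : ℝ) • ((List.ofFn fun i => flat (x i) ⊗ₜ[ℝ] flat (x i)).prod * η) =
      (wedgeMetric x ^ p) η := by
  have h := (sum_pow_of_sq_eq_zero (fun i => eL V (x i) * eR V (x i)) (fun i j => ?_)
    (fun i => ?_)).1
  · rw [wedgeMetric, h, ofFn_reverse_prod]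
    · rw [← Nat.cast_smul_eq_nsmul ℝ, LinearMap.smul_apply]
      congr 1
      clear h
      induction p with
      | zero => simp
      | succ p ih =>
        rw [List.ofFn_succ, List.ofFn_succ, List.prod_cons, List.prod_cons, mul_assoc, ih,
          flat_tmul_flat_mul]
        rfl
    · intro i j
      refine LinearMap.ext fun η => ?_
      simp only [Module.End.mul_apply]
      rw [eR_eL, eR_eR, map_neg, map_neg, eL_eL, neg_neg, eR_eL]
  · refine LinearMap.ext fun η => ?_
    simp only [Module.End.mul_apply]
    rw [eR_eL, eR_eR, map_neg, map_neg, eL_eL, neg_neg, eR_eL]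
  · refine LinearMap.ext fun η => ?_
    simp only [Module.End.mul_apply]
    rw [eR_eL, eL_self, LinearMap.zero_apply]

theorem ofFn_prod_tmul {p : ℕ} (x : Fin p → V) :
    (List.ofFn fun i => flat (x i)).prod ⊗ₜ[ℝ] (List.ofFn fun i => flat (x i)).prod =
      (List.ofFn fun i => flat (x i) ⊗ₜ[ℝ] flat (x i)).prod := by
  induction p with
  | zero => simp [Algebra.TensorProduct.one_def]
  | succ p ih =>
    simp only [List.ofFn_succ, List.prod_cons]
    rw [← ih, Algebra.TensorProduct.tmul_mul_tmul]

theorem ofFn_prod_mem {p : ℕ} (x : Fin p → V) :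
    (List.ofFn fun i => flat (x i)).prod ∈ ⋀[ℝ]^p (Module.Dual ℝ V) :=
  ExteriorAlgebra.ιMulti_range ℝ p ⟨fun i => innerₗ V (x i), rfl⟩

variable (V) in
/-- Contraction by vectors, as an algebra map on the exterior algebra of `V`. -/
def contractAlgHom : ExteriorAlgebra ℝ V →ₐ[ℝ] (Module.End ℝ (Form V))ᵐᵒᵖ :=
  ExteriorAlgebra.lift ℝ ⟨(MulOpposite.opLinearEquiv ℝ).toLinearMap ∘ₗ interiorHom V, fun v => by
    refine MulOpposite.unop_injective ?_
    refine LinearMap.ext fun α => ?_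
    exact interior_interior_self v α⟩

variable (V) in
/-- Evaluation of a fixed form, as an alternating map of the vectors. -/
def evalFormAlternating (p : ℕ) (α : Form V) : V [⋀^Fin p]→ₗ[ℝ] ℝ :=
  (ExteriorAlgebra.algebraMapInv.toLinearMap ∘ₗ LinearMap.applyₗ α ∘ₗ
    (MulOpposite.opLinearEquiv ℝ).symm.toLinearMap ∘ₗ
      (contractAlgHom V).toLinearMap).compAlternatingMap (ExteriorAlgebra.ιMulti ℝ p)

theorem evalFormAlternating_apply {p : ℕ} (α : Form V) (x : Fin p → V) :
    evalFormAlternating V p α x = evalForm x α := by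
  simp [evalFormAlternating, evalForm, ExteriorAlgebra.ιMulti_apply, map_list_prod,
    MulOpposite.unop_list_prod, contractAlgHom, List.map_ofFn, Function.comp_def,
    interiorHom_apply]

end Evaluation

/-! ### The Hodge star and complementary planes -/

section Hodge

variable {V : Type*} [NormedAddCommGroup V] [InnerProductSpace ℝ V] [FiniteDimensional ℝ V]

theorem sharp_innerₗ (v : V) : sharp (innerₗ V v) = v := by
  conv_rhs => rw [← proj_stdOrthonormalBasis v]
  simp [sharp, proj, real_inner_comm]

theorem interior_hodge (v : V) (α : Form V) : interior v (hodge α) = hodge (α * flat v) := by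
  simp [hodge, flat, interiorSharp, sharp_innerₗ]

theorem evalForm_hodge {p : ℕ} (x : Fin p → V) (α : Form V) :
    evalForm x (hodge α) =
      ExteriorAlgebra.algebraMapInv (hodge (α * (List.ofFn fun i => flat (x i)).prod)) := by
  induction p generalizing α with
  | zero => simp [evalForm_zero]
  | succ p ih => rw [evalForm_succ, interior_hodge, ih, List.ofFn_succ, List.prod_cons, mul_assoc]

theorem hodge_one : hodge (1 : Form V) = volForm V := by simp [hodge]

/-- On top-degree forms, the scalar part of the Hodge star is the value on the standard
orthonormal basis. -/
theorem algebraMapInv_hodge {α : Form V} (h : α ∈ ⋀[ℝ]^(finrank ℝ V) (Module.Dual ℝ V)) :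
    ExteriorAlgebra.algebraMapInv (hodge α) = evalForm (stdOrthonormalBasis ℝ V) α := by
  set e := stdOrthonormalBasis ℝ V
  rw [← ExteriorAlgebra.ιMulti_span_fixedDegree] at h
  let f₁ : Form V →ₗ[ℝ] ℝ := ExteriorAlgebra.algebraMapInv.toLinearMap ∘ₗ hodge
  let f₂ : Form V →ₗ[ℝ] ℝ := evalForm e
  -- Both are alternating maps of top degree on the dual space, so it suffices to compare them on
  -- the dual basis, where both give the value of the volume form on `e`.
  have key : f₁.compAlternatingMap (ExteriorAlgebra.ιMulti ℝ (finrank ℝ V)) =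
      f₂.compAlternatingMap (ExteriorAlgebra.ιMulti ℝ (finrank ℝ V)) := by
    have hb : (e.toBasis.dualBasis : _ → Module.Dual ℝ V) = fun i => innerₗ V (e i) := by
      funext i
      ext v
      simp [e.repr_apply_apply]
    rw [AlternatingMap.eq_smul_basis_det e.toBasis.dualBasis
        (f₁.compAlternatingMap (ExteriorAlgebra.ιMulti ℝ (finrank ℝ V))),
      AlternatingMap.eq_smul_basis_det e.toBasis.dualBasis
        (f₂.compAlternatingMap (ExteriorAlgebra.ιMulti ℝ (finrank ℝ V))), hb]
    congr 1
    have h1 := evalForm_hodge e (1 : Form V)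
    rw [one_mul, hodge_one] at h1
    exact h1.symm
  exact LinearMap.eqOn_span (f := f₁) (g := f₂)
    (by rintro _ ⟨θ, rfl⟩; exact DFunLike.congr_fun key θ) h

/-- Vectors inserted into `*α` become factors to the right of `α`, which raises `α` to top degree,
where the star is evaluation on an orthonormal basis. -/
theorem evalDForm_star {p q : ℕ} (hpq : q + p = finrank ℝ V) (x : Fin p → V) {η : DForm V}
    (h : η ∈ bidegree V q q) : evalDForm x x (star η) =
      evalDForm (stdOrthonormalBasis ℝ V) (stdOrthonormalBasis ℝ V)
        (η * (List.ofFn fun i => flat (x i) ⊗ₜ[ℝ] flat (x i)).prod) := by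
  refine bidegree_induction (by simp) (fun α hα β hβ => ?_)
    (fun η ζ h₁ h₂ => by simp only [map_add, h₁, h₂, add_mul]) h
  rw [← ofFn_prod_tmul, Algebra.TensorProduct.tmul_mul_tmul, evalDForm_tmul, star,
    TensorProduct.map_tmul, evalDForm_tmul, evalForm_hodge, evalForm_hodge, algebraMapInv_hodge,
    algebraMapInv_hodge]
  · exact hpq ▸ mul_mem_exteriorPower hβ (ofFn_prod_mem x)
  · exact hpq ▸ mul_mem_exteriorPower hα (ofFn_prod_mem x)

variable {r s : ℕ} {x : Fin r → V} {y : Fin s → V}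

theorem contraction_eq_add (h : ∀ u, proj x u + proj y u = u) :
    (contraction : DForm V →ₗ[ℝ] DForm V) = contr x + contr y := by
  rw [contraction_eq, contr_eq (y := Sum.elim x y) proj_stdOrthonormalBasis]
  · simp [contr]
  · intro u
    simpa [proj] using h u

/-- After `evalDForm_star`, expand `(contr x + contr y)^n` on `G * η`: `contr x` strips off the
factor `G` built from `x`, and what remains is the value of `η` on `y`. -/
theorem evalDForm_star_eq (hrs : s + r = finrank ℝ V) (hx : Orthonormal ℝ x)
    (hxy : ∀ k i, ⟪x i, y k⟫_ℝ = 0) (h : ∀ u, proj x u + proj y u = u) {η : DForm V}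
    (hη : η ∈ bidegree V s s) : evalDForm x x (star η) = evalDForm y y η := by
  rw [evalDForm_star hrs x hη]
  set G := (List.ofFn fun i => flat (x i) ⊗ₜ[ℝ] flat (x i)).prod
  have hcomm : Commute η G := by
    refine Commute.list_prod_right _ _ fun z hz => ?_
    obtain ⟨i, rfl⟩ := List.mem_ofFn.mp hz
    exact commute_flat_tmul_flat hη _ _
  have h1 := factorial_mul_evalDForm_self (stdOrthonormalBasis ℝ V) (η * G)
  rw [← contraction_eq, hcomm.eq, contraction_eq_add h] at h1
  have hc : Commute (contr y) (contr x) := by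
    exact LinearMap.ext fun η => contr_comm _ _ _
  -- Since `contr x ^ (r+1) = 0`, `contr y ^ (s+1) = 0` and `r + s = n`, a single binomial term
  -- survives.
  have h2 : (contr x + contr y) ^ (finrank ℝ V) =
      ((finrank ℝ V).choose s : ℝ) • (contr y ^ s * contr x ^ r) := by
    rw [add_comm, hc.add_pow, Finset.sum_eq_single s]
    · rw [← hrs, Nat.add_sub_cancel_left, Nat.cast_smul_eq_nsmul ℝ, nsmul_eq_mul, Nat.cast_comm]
    · intro b hb hbs
      rcases lt_or_gt_of_ne hbs with hlt | hgt
      · have : contr x ^ (finrank ℝ V - b) = 0 :=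
          pow_eq_zero_of_le (by omega) (contr_pow x).2
        rw [this]; simp
      · have : contr y ^ b = 0 := pow_eq_zero_of_le (by omega) (contr_pow y).2
        rw [this]; simp
    · intro hs
      exact absurd (Finset.mem_range.mpr (by omega)) hs
  have hxx : ∀ i, ⟪x i, x i⟫_ℝ = 1 := fun i => by simp [hx.1 i]
  have hpow : ∀ (T : Module.End ℝ (DForm V)), (∀ ζ, contr y (T ζ) = T (contr y ζ)) →
      ∀ ζ, (contr y ^ s) (T ζ) = T ((contr y ^ s) ζ) := fun T hT ζ => by
    have : Commute (contr y) T := by exact LinearMap.ext fun ζ => hT ζ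
    exact LinearMap.congr_fun (this.pow_left s) ζ
  -- The functional `aug ∘ contr y ^ s` is admissible because `contr y` commutes with all operators
  -- along the orthogonal family `x`. With `m = j = 0` and `k = r` the factor is `r! * r!`, one of
  -- which turns `wedgeMetric x ^ r` into `G`.
  have h3 := functional_lower_pow_raise_pow (c := contr x) (g := wedgeMetric x) (h := cartan x)
    (contr_wedgeMetric hxx (proj_orthonormal hx)) (contr_cartan hx)
    (ψ := aug ∘ₗ (contr y ^ s))
    (fun ζ => by
      rw [LinearMap.comp_apply, hpow _ (contr_wedgeMetric_comm hxy), aug_wedgeMetric])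
    (p := r) (fun ζ => by
      rw [LinearMap.comp_apply, hpow _ (contr_cartan_comm hxy), aug_cartan, Fintype.card_fin]; rfl)
    0 r 0 (by simp) η
  have h4 := factorial_mul_evalDForm_self y η
  rw [← ofFn_flat_tmul_flat_prod] at h3
  rw [h2] at h1
  simp only [LinearMap.comp_apply, zero_add, map_smul, pow_zero, add_zero,
    Module.End.one_apply, ← h4, LinearMap.smul_apply, Module.End.mul_apply, smul_eq_mul,
    Nat.factorial_zero, Nat.cast_one, one_mul] at h1 h3
  have h5 : ((finrank ℝ V).choose s : ℝ) * s ! * r ! = (finrank ℝ V)! := by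
    have := Nat.choose_mul_factorial_mul_factorial (n := finrank ℝ V) (k := s) (by omega)
    rw [show finrank ℝ V - s = r by omega] at this
    exact_mod_cast this
  rw [hcomm.eq]
  have hr : (r ! : ℝ) ≠ 0 := by positivity
  have hn : ((finrank ℝ V)! : ℝ) ≠ 0 := by positivity
  have h6 := mul_left_cancel₀ hr (h3.trans (mul_assoc _ _ _))
  rw [h6] at h1
  refine mul_left_cancel₀ hn (h1.trans ?_)
  rw [← h5]; ring

theorem proj_stdOrthonormalBasis_submodule (P : Submodule ℝ V) (u : V) :
    proj (fun i => (stdOrthonormalBasis ℝ P i : V)) u = P.starProjection u := by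
  rw [Submodule.starProjection_apply,
    (stdOrthonormalBasis ℝ P).orthogonalProjectionOnto_apply_eq_sum]
  simp [proj]

theorem orthonormal_stdOrthonormalBasis_submodule (P : Submodule ℝ V) :
    Orthonormal ℝ (fun i => (stdOrthonormalBasis ℝ P i : V)) :=
  (stdOrthonormalBasis ℝ P).orthonormal.comp_linearIsometry P.subtypeₗᵢ

theorem proj_add_proj_orthogonal (P : Submodule ℝ V) (u : V) :
    proj (fun i => (stdOrthonormalBasis ℝ P i : V)) u +
      proj (fun i => (stdOrthonormalBasis ℝ Pᗮ i : V)) u = u := by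
  rw [proj_stdOrthonormalBasis_submodule, proj_stdOrthonormalBasis_submodule,
    Submodule.starProjection_add_starProjection_orthogonal]

/-- The sectional curvatures of `*η` at `P` and of `η` at the orthogonal complement agree. -/
theorem sectional_star (P : Submodule ℝ V) {s : ℕ} (hs : finrank ℝ Pᗮ = s) {η : DForm V}
    (hη : η ∈ bidegree V s s) : sectional (star η) P = sectional η Pᗮ := by
  subst hs
  refine evalDForm_star_eq ?_ (orthonormal_stdOrthonormalBasis_submodule P) (fun k i => ?_)
    (proj_add_proj_orthogonal P) hη
  · rw [add_comm]; exact P.finrank_add_finrank_orthogonal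
  · exact Submodule.inner_right_of_mem_orthogonal (SetLike.coe_mem _) (SetLike.coe_mem _)

/-- Of the `i + k` contractions along `x`, `k` are absorbed by the powers of the metric through the
`sl₂` relations, leaving `i` to act on `η`. -/
theorem factorial_mul_evalDForm_metric_pow_mul {p i k : ℕ} (hp : p = i + k) {x : Fin p → V}
    (hx : Orthonormal ℝ x) (η : DForm V) :
    (i ! : ℝ) * evalDForm x x (metric V ^ k * η) = k ! * aug ((contr x ^ i) η) := by
  subst hp
  have hxx : ∀ i, ⟪x i, x i⟫_ℝ = 1 := fun i => by simp [hx.1 i]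
  have h3 := functional_lower_pow_raise_pow (c := contr x) (h := cartan x)
    (contr_wedgeMetric hxx fun i => proj_stdOrthonormalBasis (x i)) (contr_cartan hx) (ψ := aug)
    (aug_wedgeMetric _) (p := i + k) (fun ζ => by rw [aug_cartan, Fintype.card_fin])
    i k 0 rfl η
  rw [← metric_pow_mul, ← factorial_mul_evalDForm_self] at h3
  have hp : ((i + k)! : ℝ) ≠ 0 := by positivity
  simp only [Nat.factorial_zero, Nat.cast_one, mul_one, add_zero] at h3
  refine mul_left_cancel₀ hp ?_
  linear_combination h3

/-- The sectional curvature of `g^k ω` at a plane `P` through the contraction of `ω` along `P`. -/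
theorem factorial_mul_sectional_metric_pow_mul (P : Submodule ℝ V) {i k : ℕ}
    (hP : finrank ℝ P = i + k) (η : DForm V) :
    (i ! : ℝ) * sectional (metric V ^ k * η) P =
      k ! * aug ((contr (fun j => (stdOrthonormalBasis ℝ P j : V)) ^ i) η) :=
  factorial_mul_evalDForm_metric_pow_mul hP (orthonormal_stdOrthonormalBasis_submodule P) η

/-- Effectiveness says `contr y = -contr x` on `η`, and this persists on each `contr x ^ i η`, which
is again effective because contractions commute. This is the source of the sign `(-1)^i`. -/
theorem contr_pow_of_contraction_eq_zero (h : ∀ u, proj x u + proj y u = u) {η : DForm V}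
    (hη : contraction η = 0) (i : ℕ) : (contr y ^ i) η = (-1 : ℝ) ^ i • (contr x ^ i) η := by
  have hxy : ∀ ζ, contraction ζ = 0 → contr y ζ = -contr x ζ := fun ζ hζ => by
    rw [contraction_eq_add h, LinearMap.add_apply] at hζ
    exact eq_neg_of_add_eq_zero_right hζ
  have hx : ∀ i, contraction ((contr x ^ i) η) = 0 := fun i => by
    have : Commute (contr (stdOrthonormalBasis ℝ V : _ → V)) (contr x) := by
      exact LinearMap.ext fun ζ => contr_comm _ _ ζ
    have h1 := LinearMap.congr_fun (this.pow_right i) η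
    rw [Module.End.mul_apply, Module.End.mul_apply, ← contraction_eq, hη, map_zero] at h1
    exact h1
  induction i with
  | zero => simp
  | succ i ih =>
    rw [pow_succ', Module.End.mul_apply, ih, map_smul, hxy _ (hx i), pow_succ' (contr x),
      Module.End.mul_apply, pow_succ]
    module

/-- For an effective `ω`, the sectional curvatures of powers of the metric times `ω` at a plane and
at its orthogonal complement are proportional. -/
theorem sectional_orthogonal_metric_pow_mul (P : Submodule ℝ V) {i k l : ℕ}
    (hP : finrank ℝ P = i + k) (hP' : finrank ℝ Pᗮ = i + l) {η : DForm V}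
    (hη : contraction η = 0) :
    (k ! : ℝ) * sectional (metric V ^ l * η) Pᗮ =
      (-1) ^ i * l ! * sectional (metric V ^ k * η) P := by
  have h1 := factorial_mul_sectional_metric_pow_mul P hP η
  have h2 := factorial_mul_sectional_metric_pow_mul Pᗮ hP' η
  rw [contr_pow_of_contraction_eq_zero (proj_add_proj_orthogonal P) hη, map_smul,
    smul_eq_mul] at h2
  have hi : (i ! : ℝ) ≠ 0 := by positivity
  refine mul_left_cancel₀ hi ?_
  linear_combination (k ! : ℝ) * h2 - (-1) ^ i * (l ! : ℝ) * h1

end Hodge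

end DoubleForms

end

noncomputable section

namespace DoubleForms

open scoped InnerProductSpace

/-! ### Decomposition into effective components -/

section Decomposition

variable {V : Type*} [NormedAddCommGroup V] [InnerProductSpace ℝ V] [FiniteDimensional ℝ V]

theorem exists_isEffectiveDecomposition {p : ℕ} (hp : 2 * p ≤ finrank ℝ V) {Ω : DForm V}
    (h : Ω ∈ bidegree V p p) : ∃ η, IsEffectiveDecomposition p Ω η := by
  induction p generalizing Ω with
  | zero =>
    refine ⟨fun _ => Ω, fun i hi => ?_, fun i _ => contraction_of_mem_zero h, by simp⟩
    rwa [Nat.le_zero.mp hi]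
  | succ p ih =>
    obtain ⟨ξ, hmem, heff, hsum⟩ := ih (by omega) (contraction_mem h)
    -- The factor by which contraction sends `g^(p+1-i) ωᵢ` to `g^(p-i) ωᵢ`. Dividing by it lifts a
    -- decomposition of the contraction of `Ω` to a form `Ω'` with the same contraction, and `Ω -
    -- Ω'` is the new effective component.
    let a : ℕ → ℝ := fun i => (((p - i : ℕ) : ℝ) + 1) * ((finrank ℝ V - i - i : ℝ) - (p - i : ℕ))
    have ha : ∀ i ≤ p, a i ≠ 0 := fun i hi => by
      have h1 : (2 * (p + 1) : ℝ) ≤ finrank ℝ V := by exact_mod_cast hp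
      have h2 : (i : ℝ) ≤ p := by exact_mod_cast hi
      simp only [a, Nat.cast_sub hi]
      refine mul_ne_zero ?_ ?_
      · exact (by linarith : (0 : ℝ) < p - i + 1).ne'
      · exact (by linarith : (0 : ℝ) < finrank ℝ V - i - i - (p - i)).ne'
    set Ω' := ∑ i ∈ Finset.range (p + 1), metric V ^ (p + 1 - i) * ((a i)⁻¹ • ξ i) with hΩ'
    have hmem' : Ω' ∈ bidegree V (p + 1) (p + 1) := sum_mem fun i hi => by
      have hi' : i ≤ p := Finset.mem_range_succ_iff.mp hi
      have := metric_pow_mul_mem (k := p + 1 - i) (Submodule.smul_mem _ (a i)⁻¹ (hmem i hi'))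
      rwa [Nat.sub_add_cancel (by omega)] at this
    have hc : contraction Ω' = contraction Ω := by
      rw [hΩ', map_sum, hsum]
      refine Finset.sum_congr rfl fun i hi => ?_
      have hi' : i ≤ p := Finset.mem_range_succ_iff.mp hi
      rw [mul_smul_comm, map_smul, Nat.succ_sub hi', Nat.succ_eq_add_one,
        contraction_metric_pow_mul (heff i hi') (cartan_std_of_mem (hmem i hi')), smul_smul,
        inv_mul_cancel₀ (ha i hi'), one_smul]
    refine ⟨fun i => if i ≤ p then (a i)⁻¹ • ξ i else Ω - Ω', fun i hi => ?_, fun i hi => ?_, ?_⟩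
    · by_cases h' : i ≤ p
      · simpa only [h', if_true] using Submodule.smul_mem _ _ (hmem i h')
      · obtain rfl : i = p + 1 := by omega
        simpa using sub_mem h hmem'
    · by_cases h' : i ≤ p
      · simp only [h', if_true, map_smul, heff i h', smul_zero]
      · simp only [h', if_false, map_sub, hc, sub_self]
    · rw [Finset.sum_range_succ, Finset.sum_congr rfl (g := fun i =>
        metric V ^ (p + 1 - i) * ((a i)⁻¹ • ξ i)) fun i hi => by
          rw [if_pos (Finset.mem_range_succ_iff.mp hi)]]
      rw [if_neg (by omega), Nat.sub_self, pow_zero, one_mul, ← hΩ', add_sub_cancel]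

/-- Uniqueness of the effective components. -/
theorem eq_zero_of_sum_metric_pow_mul_eq_zero {p : ℕ} {ζ : ℕ → DForm V}
    (hw : ∀ i ≤ p, cartan (stdOrthonormalBasis ℝ V : _ → V) (ζ i) =
      (finrank ℝ V - i - i : ℝ) • ζ i)
    (hc : ∀ i ≤ p, contraction (ζ i) = 0) (hbig : ∀ i ≤ p, finrank ℝ V < i + p → ζ i = 0)
    (hsum : ∑ i ∈ Finset.range (p + 1), metric V ^ (p - i) * ζ i = 0) : ∀ i ≤ p, ζ i = 0 := by
  induction p generalizing ζ with
  | zero =>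
    intro i hi
    rw [Nat.le_zero.mp hi]
    simpa using hsum
  | succ p ih =>
    let a : ℕ → ℝ := fun i => (((p - i : ℕ) : ℝ) + 1) * ((finrank ℝ V - i - i : ℝ) - (p - i : ℕ))
    have hsmall : ∀ i ≤ p, ζ i = 0 := by
      -- Contraction kills the top component and rescales the others by `a i`, so the induction
      -- hypothesis applies to `a i • ζ i`. The factor is nonzero when `i + (p + 1) ≤ n`; the other
      -- indices are covered by `hbig`.
      have h1 := congrArg contraction hsum
      rw [map_zero, map_sum, Finset.sum_range_succ, Nat.sub_self, pow_zero, one_mul,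
        hc _ le_rfl, add_zero] at h1
      have h2 := ih (ζ := fun i => a i • ζ i)
        (fun i hi => by rw [map_smul, hw i (by omega), smul_comm])
        (fun i hi => by rw [map_smul, hc i (by omega), smul_zero])
        (fun i hi hlt => by rw [hbig i (by omega) (by omega), smul_zero])
        (by
          rw [← h1]
          refine Finset.sum_congr rfl fun i hi => ?_
          have hi' : i ≤ p := Finset.mem_range_succ_iff.mp hi
          rw [mul_smul_comm, Nat.succ_sub hi', Nat.succ_eq_add_one,
            contraction_metric_pow_mul (hc i (by omega)) (hw i (by omega))])
      intro i hi
      by_cases hlt : finrank ℝ V < i + (p + 1)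
      · exact hbig i (by omega) hlt
      · refine (smul_eq_zero.mp (h2 i hi)).resolve_left ?_
        have h3 : (i + (p + 1) : ℝ) ≤ finrank ℝ V := by exact_mod_cast not_lt.mp hlt
        simp only [a, Nat.cast_sub hi]
        have h4 : (i : ℝ) ≤ p := by exact_mod_cast hi
        refine mul_ne_zero ?_ ?_
        · exact (by linarith : (0 : ℝ) < p - i + 1).ne'
        · exact (by linarith : (0 : ℝ) < finrank ℝ V - i - i - (p - i)).ne'
    intro i hi
    by_cases h' : i ≤ p
    · exact hsmall i h'
    · obtain rfl : i = p + 1 := by omega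
      rw [Finset.sum_range_succ, Finset.sum_eq_zero, zero_add] at hsum
      · simpa using hsum
      · intro i hi
        rw [hsmall i (Finset.mem_range_succ_iff.mp hi), mul_zero]

end Decomposition

/-! ### The first Bianchi identity -/

section Bianchi

variable {V : Type*} [NormedAddCommGroup V] [InnerProductSpace ℝ V]
variable {κ : Type*} [Fintype κ] {b : κ → V}

/-- Moving the right factor `v` to the left produces the extra term. For `u = v` it vanishes, whence
the commutation with the metric. -/
theorem bianchi_eL_eR (hb : ∀ u, proj b u = u) (u v : V) (η : DForm V) :
    bianchi b (eL V u (eR V v η)) = eL V v (eL V u η) + eL V u (eR V v (bianchi b η)) := by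
  conv_rhs => enter [1]; rw [← hb v]
  rw [← map_proj]
  simp only [bianchi_apply, map_sum, iR_eL, iR_eR, map_sub, map_smul, ← Finset.sum_add_distrib]
  refine Finset.sum_congr rfl fun k _ => ?_
  rw [eL_eL (b k) u (eR V v _), real_inner_comm, eR_eL]
  abel

/-- The only obstruction to commuting is the square of `iR V u`, which is zero. -/
theorem bianchi_iL_iR (hb : ∀ u, proj b u = u) (u : V) (η : DForm V) :
    iL V u (iR V u (bianchi b η)) = bianchi b (iL V u (iR V u η)) := by
  have h : ∑ k, ⟪b k, u⟫_ℝ • iR V (b k) (iR V u η) = 0 := by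
    rw [map_proj, hb, iR_self]
  rw [← sub_eq_zero, ← neg_eq_zero, ← h]
  simp only [bianchi_apply, map_sum, iR_eL, iL_eL, iR_iR u, map_neg, ← Finset.sum_sub_distrib,
    ← Finset.sum_neg_distrib, iR_iL]
  exact Finset.sum_congr rfl fun k _ => by abel

theorem bianchi_contr (hb : ∀ u, proj b u = u) {ι : Type*} [Fintype ι] (x : ι → V)
    (η : DForm V) : contr x (bianchi b η) = bianchi b (contr x η) := by
  simp only [contr_apply, map_sum, bianchi_iL_iR hb]

theorem bianchi_wedgeMetric (hb : ∀ u, proj b u = u) {ι : Type*} [Fintype ι] (x : ι → V)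
    (η : DForm V) : bianchi b (wedgeMetric x η) = wedgeMetric x (bianchi b η) := by
  simp only [wedgeMetric_apply, map_sum, bianchi_eL_eR hb, eL_self, zero_add]

theorem cartan_bianchi (hb : ∀ u, proj b u = u) (η : DForm V) :
    cartan b (bianchi b η) = bianchi b (cartan b η) := by
  simp only [cartan_apply, bianchi_apply, map_sum, map_sub, map_smul, eulerL_eL, eulerR_eL,
    eulerL_iR, eulerR_iR, hb, Finset.sum_add_distrib, Finset.sum_sub_distrib, Finset.smul_sum]
  abel

theorem bianchi_algebraMap (b : κ → V) (a : ℝ) : bianchi b (algebraMap ℝ (DForm V) a) = 0 := by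
  rw [bianchi_apply, Algebra.TensorProduct.algebraMap_apply, ← map_one (algebraMap ℝ (Form V))]
  simp [iR_tmul, interior_algebraMap, -map_one]

theorem eL_rotate (u v w : V) (η : DForm V) :
    eL V v (eL V w (eL V u η)) = eL V u (eL V v (eL V w η)) := by
  rw [eL_eL w u, map_neg, eL_eL v u, neg_neg]

theorem evalDForm_cons {p : ℕ} (v : V) (x : Fin p → V) (η : DForm V) :
    evalDForm x x (iL V v (iR V v η)) =
      evalDForm (Fin.cons v x : Fin (p + 1) → V) (Fin.cons v x : Fin (p + 1) → V) η := by
  rw [evalDForm_self_succ]; simp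

/-- A double form which satisfies the first Bianchi identity is determined by its values
on the diagonal. -/
theorem eq_zero_of_bianchi_of_evalDForm_self (hb : ∀ u, proj b u = u) {p : ℕ} {η : DForm V}
    (hη : η ∈ bidegree V p p) (hS : bianchi b η = 0)
    (h : ∀ x : Fin p → V, evalDForm x x η = 0) : η = 0 := by
  induction p generalizing η with
  | zero =>
    obtain ⟨a, rfl⟩ := exists_of_mem_bidegree_zero hη
    have := h Fin.elim0
    rw [evalDForm_self_zero, aug_algebraMap] at this
    rw [this, map_zero]
  | succ p ih =>
    have h1 : ∀ v, iL V v (iR V v η) = 0 := fun v => by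
      refine ih (iL_mem v (iR_mem v hη)) ?_ fun x => ?_
      · rw [← bianchi_iL_iR hb, hS, map_zero, map_zero]
      · rw [evalDForm_cons, h]
    -- Polarization of `h1`. With this skewness, `iL V v` applied to the Bianchi sum yields `iR V v
    -- η` once from the commutator and `p + 1` times from the left degree, so the identity forces
    -- `iR V v η = 0`.
    have h2 : ∀ u v, iL V u (iR V v η) = -iL V v (iR V u η) := fun u v => by
      have := h1 (u + v)
      simp only [map_add, LinearMap.add_apply, h1, zero_add, add_zero] at this
      exact eq_neg_of_add_eq_zero_right this
    have h3 : ∀ v, iR V v η = 0 := fun v => by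
      have h4 : iL V v (bianchi b η) = ((p + 1 : ℕ) + 1 : ℝ) • iR V v η := by
        have h5 : ∑ k, ⟪b k, v⟫_ℝ • iR V (b k) η = iR V v η := by rw [map_proj, hb]
        rw [add_smul, ← eulerL_of_mem hb (iR_mem v hη), one_smul]
        conv_rhs => enter [2]; rw [← h5]
        simp only [bianchi_apply, eulerL_apply, map_sum, iL_eL, h2 v, map_neg]
        rw [← Finset.sum_add_distrib]
        exact Finset.sum_congr rfl fun k _ => by abel
      rw [hS, map_zero] at h4
      refine (smul_eq_zero.mp h4.symm).resolve_left ?_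
      positivity
    have h6 := eulerR_of_mem hb hη
    rw [eulerR_apply, Finset.sum_eq_zero fun k _ => by rw [h3, map_zero]] at h6
    refine (smul_eq_zero.mp h6.symm).resolve_left ?_
    positivity

variable [FiniteDimensional ℝ V]

/-- Both tensor factors scale by the same change-of-basis determinant, so `d` is its square. -/
theorem evalDForm_self_of_mem (P : Submodule ℝ V) {p : ℕ} (hP : finrank ℝ P = p) {x : Fin p → V}
    (hx : ∀ i, x i ∈ P) : ∃ d : ℝ, ∀ η, evalDForm x x η = d * sectional η P := by
  subst hP
  set e := stdOrthonormalBasis ℝ P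
  have key : ∀ α : Form V, evalForm x α = evalForm (fun i => (e i : V)) α *
      e.toBasis.det (fun i => ⟨x i, hx i⟩) := fun α => by
    have := DFunLike.congr_fun (AlternatingMap.eq_smul_basis_det e.toBasis
      ((evalFormAlternating V _ α).compLinearMap P.subtype)) (fun i => ⟨x i, hx i⟩)
    simpa [evalFormAlternating_apply] using this
  refine ⟨e.toBasis.det (fun i => ⟨x i, hx i⟩) ^ 2, fun η => ?_⟩
  refine apply_eq_of_tmul (g := (e.toBasis.det (fun i => ⟨x i, hx i⟩) ^ 2) •
    evalDForm (fun i => (e i : V)) (fun i => (e i : V))) (fun α β => ?_) η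
  rw [LinearMap.smul_apply, evalDForm_tmul, evalDForm_tmul, key, key, smul_eq_mul]
  ring

/-- A double form which satisfies the first Bianchi identity is determined by its sectional
curvatures. -/
theorem eq_zero_of_sectional_eq_zero {p : ℕ} {η : DForm V} (hη : η ∈ bidegree V p p)
    (hS : bianchi (stdOrthonormalBasis ℝ V : _ → V) η = 0)
    (h : ∀ P : Submodule ℝ V, finrank ℝ P = p → sectional η P = 0) : η = 0 := by
  refine eq_zero_of_bianchi_of_evalDForm_self proj_stdOrthonormalBasis hη hS fun x => ?_
  by_cases hx : LinearIndependent ℝ x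
  · have hP : finrank ℝ (Submodule.span ℝ (Set.range x)) = p := by
      rw [finrank_span_eq_card hx, Fintype.card_fin]
    obtain ⟨d, hd⟩ := evalDForm_self_of_mem _ hP fun i =>
      Submodule.subset_span (Set.mem_range_self i)
    rw [hd, h _ hP, mul_zero]
  · refine apply_eq_of_tmul (g := 0) (fun α β => ?_) η
    rw [evalDForm_tmul, ← evalFormAlternating_apply α, AlternatingMap.map_linearDependent _ _ hx,
      zero_mul, LinearMap.zero_apply]

theorem bianchi_metric_pow_mul (k : ℕ) (η : DForm V) :
    bianchi (stdOrthonormalBasis ℝ V : _ → V) (metric V ^ k * η) =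
      metric V ^ k * bianchi (stdOrthonormalBasis ℝ V : _ → V) η := by
  induction k with
  | zero => simp
  | succ k ih =>
    rw [pow_succ', mul_assoc, mul_assoc, metric_mul,
      bianchi_wedgeMetric proj_stdOrthonormalBasis, ih, ← metric_mul]

/-- The effective components inherit the first Bianchi identity. -/
theorem IsEffectiveDecomposition.bianchi_eq_zero {p : ℕ} {Ω : DForm V} {η : ℕ → DForm V}
    (h : IsEffectiveDecomposition p Ω η) (hp : p + p ≤ finrank ℝ V)
    (hΩ : bianchi (stdOrthonormalBasis ℝ V : _ → V) Ω = 0) :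
    ∀ i ≤ p, bianchi (stdOrthonormalBasis ℝ V : _ → V) (η i) = 0 := by
  -- The image of `η i` under the Bianchi operator no longer has bidegree `(i, i)` but keeps its
  -- total degree; this is why uniqueness is stated through the Cartan weight.
  refine eq_zero_of_sum_metric_pow_mul_eq_zero (fun i hi => ?_) (fun i hi => ?_)
    (fun i hi hlt => by omega) ?_
  · rw [cartan_bianchi proj_stdOrthonormalBasis, cartan_std_of_mem (h.mem i hi), map_smul]
  · rw [contraction_eq, bianchi_contr proj_stdOrthonormalBasis, ← contraction_eq,
      h.effective i hi, map_zero]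
  · simp only [← bianchi_metric_pow_mul, ← map_sum, ← h.sum_eq, hΩ]

theorem sum_rotate {ι W : Type*} [Fintype ι] [AddCommMonoid W] (f : ι → ι → ι → W) :
    ∑ i, ∑ j, ∑ k, f j k i = ∑ i, ∑ j, ∑ k, f i j k := by
  rw [Finset.sum_comm]
  exact Finset.sum_congr rfl fun j _ => Finset.sum_comm

theorem sum_comm_four {ι W : Type*} [Fintype ι] [AddCommMonoid W] (f : ι → ι → ι → ι → W) :
    ∑ i, ∑ j, ∑ k, ∑ l, f i j k l = ∑ l, ∑ i, ∑ j, ∑ k, f i j k l := by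
  have h : ∀ i j, ∑ k, ∑ l, f i j k l = ∑ l, ∑ k, f i j k l := fun _ _ => Finset.sum_comm
  have h' : ∀ i, ∑ j, ∑ l, ∑ k, f i j k l = ∑ l, ∑ j, ∑ k, f i j k l := fun _ => Finset.sum_comm
  simp only [h, h']
  exact Finset.sum_comm

/-- Relabelling the indices cyclically gives three equal copies of the sum, whose total is zero. -/
theorem sum_smul_eq_zero_of_cyclic {ι W : Type*} [Fintype ι] [AddCommGroup W] [Module ℝ W]
    {a : ι → ι → ι → ℝ} {F : ι → ι → ι → W} (ha : ∀ i j k, a i j k + a j k i + a k i j = 0)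
    (hF : ∀ i j k, F j k i = F i j k) : ∑ i, ∑ j, ∑ k, a i j k • F i j k = 0 := by
  have h1 : ∑ i, ∑ j, ∑ k, a j k i • F i j k = ∑ i, ∑ j, ∑ k, a i j k • F i j k := by
    rw [← sum_rotate fun i j k => a i j k • F i j k]
    simp only [hF]
  have h2 : ∑ i, ∑ j, ∑ k, a k i j • F i j k = ∑ i, ∑ j, ∑ k, a i j k • F i j k := by
    rw [← sum_rotate fun i j k => a k i j • F i j k]
    simp only [hF]
  have h3 : ∑ i, ∑ j, ∑ k, (a i j k + a j k i + a k i j) • F i j k = 0 := by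
    simp [ha]
  simp only [add_smul, Finset.sum_add_distrib, h1, h2] at h3
  have h4 : (3 : ℝ) • ∑ i, ∑ j, ∑ k, a i j k • F i j k = 0 := by
    rw [← h3]; module
  exact (smul_eq_zero.mp h4).resolve_left three_ne_zero

theorem ofTensor_mem (T : V → V → V → V → ℝ) : ofTensor T ∈ bidegree V 2 2 := by
  have h : ∀ u v : V, flat u * flat v ∈ ⋀[ℝ]^2 (Module.Dual ℝ V) := fun u v => by
    simpa using flat_mul_mem_exteriorPower u
      (flat_mul_mem_exteriorPower v (algebraMap_mem_exteriorPower_zero (V := V) 1))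
  exact Submodule.smul_mem _ _ (sum_mem fun i _ => sum_mem fun j _ => sum_mem fun k _ =>
    sum_mem fun l _ => Submodule.smul_mem _ _ (tmul_mem_bidegree (h _ _) (h _ _)))

theorem ofTensor_mul (T : V → V → V → V → ℝ) (η : DForm V) :
    ofTensor T * η =
      let e := stdOrthonormalBasis ℝ V
      (1 / 4 : ℝ) • ∑ i, ∑ j, ∑ k, ∑ l, T (e i) (e j) (e k) (e l) •
        eL V (e i) (eR V (e k) (eL V (e j) (eR V (e l) η))) := by
  simp only [ofTensor, smul_mul_assoc, Finset.sum_mul, ← flat_tmul_flat_mul]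
  simp only [← mul_assoc, Algebra.TensorProduct.tmul_mul_tmul]

/-- The operator moves either the third or the fourth slot of `T` to the left. The resulting left
triple product is cyclically invariant, so each extra term vanishes by the cyclic identity, in slots
1, 2, 3 (`h1`) or 1, 2, 4 (`h2`). -/
theorem bianchi_ofTensor_mul {T : V → V → V → V → ℝ} (hskew : ∀ x y z w, T x y z w = -T x y w z)
    (hcyc : ∀ x y z w, T x y z w + T y w z x + T w x z y = 0) (η : DForm V) :
    bianchi (stdOrthonormalBasis ℝ V : _ → V) (ofTensor T * η) =
      ofTensor T * bianchi (stdOrthonormalBasis ℝ V : _ → V) η := by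
  rw [ofTensor_mul, ofTensor_mul]
  dsimp only
  generalize he : (stdOrthonormalBasis ℝ V : _ → V) = e
  have hb : ∀ u, proj e u = u := he ▸ proj_stdOrthonormalBasis
  have hcyc' : ∀ x y z w, T x y z w + T y z x w + T z x y w = 0 := fun x y z w => by
    have := hcyc x y w z
    rw [hskew x y z w, hskew y z x w, hskew z x y w]
    linarith
  have h1 : ∑ i, ∑ j, ∑ k, ∑ l, T (e i) (e j) (e k) (e l) •
      eL V (e k) (eL V (e i) (eL V (e j) (eR V (e l) η))) = 0 := by
    rw [sum_comm_four]
    refine Finset.sum_eq_zero fun l _ => ?_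
    exact sum_smul_eq_zero_of_cyclic (fun i j k => hcyc' _ _ _ _)
      (fun i j k => eL_rotate (e k) (e i) (e j) _)
  have h2 : ∑ i, ∑ j, ∑ k, ∑ l, T (e i) (e j) (e k) (e l) •
      eL V (e i) (eR V (e k) (eL V (e l) (eL V (e j) η))) = 0 := by
    have : ∀ i, ∑ j, ∑ k, ∑ l, T (e i) (e j) (e k) (e l) •
        eL V (e i) (eR V (e k) (eL V (e l) (eL V (e j) η))) =
        ∑ k, ∑ j, ∑ l, T (e i) (e j) (e k) (e l) •
        eL V (e i) (eR V (e k) (eL V (e l) (eL V (e j) η))) := fun i => Finset.sum_comm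
    simp only [this]
    rw [Finset.sum_comm]
    refine Finset.sum_eq_zero fun k _ => ?_
    refine sum_smul_eq_zero_of_cyclic (fun i j l => hcyc _ _ _ _) (fun i j l => ?_)
    simp only [eR_eL]
    rw [eL_rotate (e j) (e i) (e l)]
  simp only [map_smul, map_sum, bianchi_eL_eR hb, smul_add, Finset.sum_add_distrib, map_add, h1,
    h2, zero_add]

theorem bianchi_ofTensor_pow {T : V → V → V → V → ℝ} (hskew : ∀ x y z w, T x y z w = -T x y w z)
    (hcyc : ∀ x y z w, T x y z w + T y w z x + T w x z y = 0) (q : ℕ) :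
    bianchi (stdOrthonormalBasis ℝ V : _ → V) (ofTensor T ^ q) = 0 := by
  induction q with
  | zero => rw [pow_zero, ← map_one (algebraMap ℝ (DForm V)), bianchi_algebraMap]
  | succ q ih => rw [pow_succ', bianchi_ofTensor_mul hskew hcyc, ih, mul_zero]

end Bianchi

end DoubleForms

end

noncomputable section

namespace DoubleForms

open scoped InnerProductSpace

/-! ### The `(p, q)`-curvatures in terms of the effective components -/

section Curvature

variable {V : Type*} [NormedAddCommGroup V] [InnerProductSpace ℝ V] [FiniteDimensional ℝ V]

theorem sectional_smul (a : ℝ) (η : DForm V) (P : Submodule ℝ V) :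
    sectional (a • η) P = a * sectional η P := by simp [sectional]

theorem sectional_sub (η ζ : DForm V) (P : Submodule ℝ V) :
    sectional (η - ζ) P = sectional η P - sectional ζ P := by simp [sectional]

theorem sectional_sum {ι : Type*} (s : Finset ι) (f : ι → DForm V) (P : Submodule ℝ V) :
    sectional (∑ i ∈ s, f i) P = ∑ i ∈ s, sectional (f i) P := by simp [sectional]

theorem sectional_metric_pow_mul_algebraMap {P : Submodule ℝ V} {r : ℕ} (hP : finrank ℝ P = r)
    (a : ℝ) : sectional (metric V ^ r * algebraMap ℝ _ a) P = r ! * a := by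
  have := factorial_mul_sectional_metric_pow_mul P (i := 0) (k := r) (by omega)
    (algebraMap ℝ (DForm V) a)
  simpa [aug_algebraMap, -Algebra.TensorProduct.algebraMap_apply] using this

/-- When the sectional curvature of `∑ bᵢ g^{r-i} ωᵢ` is constant, for effective `ωᵢ` which satisfy
the first Bianchi identity. -/
theorem sectional_sum_eq_const_iff {N r : ℕ} (hN : N ≤ r) (hr : r + N ≤ finrank ℝ V)
    {η : ℕ → DForm V} (hmem : ∀ i ≤ N, η i ∈ bidegree V i i)
    (heff : ∀ i ≤ N, contraction (η i) = 0)
    (hS : ∀ i ≤ N, bianchi (stdOrthonormalBasis ℝ V : _ → V) (η i) = 0) (b : ℕ → ℝ) (c : ℝ) :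
    (∀ P : Submodule ℝ V, finrank ℝ P = r →
      sectional (∑ i ∈ Finset.range (N + 1), b i • (metric V ^ (r - i) * η i)) P = c) ↔
    (∀ i, 1 ≤ i → i ≤ N → b i = 0 ∨ η i = 0) ∧ (r ! * b 0) • η 0 = algebraMap ℝ _ c := by
  set Ψ := ∑ i ∈ Finset.range (N + 1), b i • (metric V ^ (r - i) * η i) with hΨ
  have hr0 : (r ! : ℝ) ≠ 0 := by positivity
  constructor
  · intro h
    -- The form `g^r` has sectional curvature `r!` at every `r`-plane, so the constant `c` is that
    -- of `(c / r!) g^r`.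
    have hscal : algebraMap ℝ (DForm V) (c / r !) ∈ bidegree V 0 0 := algebraMap_mem_bidegree _
    have hzero : Ψ - metric V ^ r * algebraMap ℝ _ (c / r !) = 0 := by
      refine eq_zero_of_sectional_eq_zero (p := r) (sub_mem (sum_mem fun i hi => ?_) ?_) ?_ ?_
      · have hi' : i ≤ N := Finset.mem_range_succ_iff.mp hi
        have := metric_pow_mul_mem (k := r - i) (hmem i hi')
        rw [Nat.sub_add_cancel (by omega)] at this
        exact Submodule.smul_mem _ _ this
      · simpa only [add_zero] using metric_pow_mul_mem (k := r) hscal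
      · rw [map_sub, bianchi_metric_pow_mul, bianchi_algebraMap, mul_zero, sub_zero, map_sum]
        refine Finset.sum_eq_zero fun i hi => ?_
        rw [map_smul, bianchi_metric_pow_mul, hS i (Finset.mem_range_succ_iff.mp hi), mul_zero,
          smul_zero]
      · intro P hP
        rw [sectional_sub, h P hP, sectional_metric_pow_mul_algebraMap hP]
        field_simp
        ring
    -- The components of the vanishing form `hzero`, padded by zero from `N + 1` to `r`. The padding
    -- together with `r + N ≤ n` supplies the large-index hypothesis of uniqueness.
    let ζ : ℕ → DForm V := fun i =>
      (if i ≤ N then b i • η i else 0) - if i = 0 then algebraMap ℝ (DForm V) (c / r !) else 0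
    have hζ : ∀ i ≤ r, ζ i = 0 := by
      have hmem' : ∀ i, ζ i ∈ bidegree V i i := fun i => by
        refine sub_mem ?_ ?_
        · split_ifs with h'
          · exact Submodule.smul_mem _ _ (hmem i h')
          · exact zero_mem _
        · split_ifs with h'
          · exact h' ▸ hscal
          · exact zero_mem _
      refine eq_zero_of_sum_metric_pow_mul_eq_zero (fun i _ => cartan_std_of_mem (hmem' i))
        (fun i _ => ?_) (fun i _ hlt => ?_) ?_
      · simp only [ζ, map_sub]
        rw [sub_eq_zero]
        trans (0 : DForm V)
        · split_ifs with h'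
          · rw [map_smul, heff i h', smul_zero]
          · exact map_zero _
        · split_ifs with h'
          · exact (contraction_of_mem_zero hscal).symm
          · exact (map_zero _).symm
      · simp only [ζ]
        rw [if_neg (by omega), if_neg (by omega), sub_zero]
      · simp only [ζ, mul_sub, Finset.sum_sub_distrib]
        refine Eq.trans ?_ hzero
        congr 1
        · rw [← Finset.sum_subset (Finset.range_mono (Nat.succ_le_succ hN)) fun i _ hi => by
            rw [if_neg (by simpa using hi), mul_zero]]
          refine Finset.sum_congr rfl fun i hi => ?_
          rw [if_pos (Finset.mem_range_succ_iff.mp hi), mul_smul_comm]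
        · rw [Finset.sum_eq_single 0]
          · simp
          · intro i _ hi; rw [if_neg hi, mul_zero]
          · simp
    refine ⟨fun i h1 hi => ?_, ?_⟩
    · have := hζ i (by omega)
      simp only [ζ, if_pos hi, if_neg (show i ≠ 0 by omega), sub_zero] at this
      exact smul_eq_zero.mp this
    · have := hζ 0 (by omega)
      simp only [ζ, if_pos (Nat.zero_le N), if_pos] at this
      rw [mul_smul, sub_eq_zero.mp this, Algebra.algebraMap_eq_smul_one, smul_smul,
        mul_div_cancel₀ _ hr0, ← Algebra.algebraMap_eq_smul_one]
  · rintro ⟨h1, h0⟩ P hP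
    obtain ⟨w, hw⟩ := exists_of_mem_bidegree_zero (hmem 0 (Nat.zero_le N))
    have hc : r ! * b 0 * w = c := by
      apply algebraMap_dform_injective (V := V)
      rw [← h0, ← hw, map_mul, Algebra.smul_def]
    have : Ψ = b 0 • (metric V ^ r * η 0) := by
      rw [hΨ, Finset.sum_eq_single 0]
      · rw [Nat.sub_zero]
      · intro i hi hi0
        rcases h1 i (by omega) (Finset.mem_range_succ_iff.mp hi) with h | h
        · rw [h, zero_smul]
        · rw [h, mul_zero, smul_zero]
      · simp
    rw [this, sectional_smul, ← hw, sectional_metric_pow_mul_algebraMap hP, ← hc]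
    ring

variable {R : DForm V} {q r : ℕ} {η : ℕ → DForm V}

theorem metric_pow_mul_of_isEffectiveDecomposition {Ω : DForm V} {p : ℕ}
    (h : IsEffectiveDecomposition p Ω η) (k : ℕ) :
    metric V ^ k * Ω = ∑ i ∈ Finset.range (p + 1), metric V ^ (k + p - i) * η i := by
  rw [h.sum_eq, Finset.mul_sum]
  refine Finset.sum_congr rfl fun i hi => ?_
  rw [← mul_assoc, ← pow_add, Nat.add_sub_assoc (Finset.mem_range_succ_iff.mp hi)]

theorem metric_pow_mul_pow_mem (hR : R ∈ bidegree V 2 2) (k : ℕ) :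
    metric V ^ k * R ^ q ∈ bidegree V (k + 2 * q) (k + 2 * q) :=
  metric_pow_mul_mem (pow_mem_bidegree hR q)

/-- The star moves the computation to `Pᗮ`, and effectiveness moves each component back to `P`, with
the sign and the factorial quotient. -/
theorem sectional_pqTensor (hR : R ∈ bidegree V 2 2) (hr : 2 * q ≤ r)
    (hrn : r + 2 * q ≤ finrank ℝ V) (hη : IsEffectiveDecomposition (2 * q) (R ^ q) η)
    {P : Submodule ℝ V} (hP : finrank ℝ P = r) :
    sectional (pqTensor R r q) P = ∑ i ∈ Finset.range (2 * q + 1),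
      (-1) ^ i * (finrank ℝ V - r - i)! / ((finrank ℝ V - 2 * q - r)! * (r - i)!) *
        sectional (metric V ^ (r - i) * η i) P := by
  have hP' : finrank ℝ Pᗮ = finrank ℝ V - r := by
    have := P.finrank_add_finrank_orthogonal
    omega
  have hmem := metric_pow_mul_pow_mem (q := q) hR (finrank ℝ V - 2 * q - r)
  rw [show finrank ℝ V - 2 * q - r + 2 * q = finrank ℝ V - r by omega] at hmem
  rw [pqTensor, sectional_smul, sectional_star P hP' hmem,
    metric_pow_mul_of_isEffectiveDecomposition hη, sectional_sum, Finset.mul_sum]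
  refine Finset.sum_congr rfl fun i hi => ?_
  have hi' := Finset.mem_range_succ_iff.mp hi
  have := sectional_orthogonal_metric_pow_mul P (i := i) (k := r - i) (l := finrank ℝ V - r - i)
    (by omega) (by omega) (hη.effective i hi')
  rw [show finrank ℝ V - 2 * q - r + 2 * q - i = finrank ℝ V - r - i by omega]
  have h1 : ((r - i)! : ℝ) ≠ 0 := by positivity
  have h2 : ((finrank ℝ V - 2 * q - r)! : ℝ) ≠ 0 := by positivity
  field_simp
  linear_combination this

/-- Here the star already leads from `Pᗮ` to `P`, so no sign appears. -/
theorem sectional_pqTensor_orthogonal (hR : R ∈ bidegree V 2 2) (hr : 2 * q ≤ r)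
    (hrn : r + 2 * q ≤ finrank ℝ V) (hη : IsEffectiveDecomposition (2 * q) (R ^ q) η)
    {P : Submodule ℝ V} (hP : finrank ℝ P = r) :
    sectional (pqTensor R (finrank ℝ V - r) q) Pᗮ = ∑ i ∈ Finset.range (2 * q + 1),
      ((r - 2 * q)! : ℝ)⁻¹ * sectional (metric V ^ (r - i) * η i) P := by
  have hmem := metric_pow_mul_pow_mem (q := q) hR (r - 2 * q)
  rw [Nat.sub_add_cancel hr] at hmem
  rw [pqTensor, show finrank ℝ V - 2 * q - (finrank ℝ V - r) = r - 2 * q by omega, sectional_smul,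
    sectional_star Pᗮ (s := r) (by rw [Submodule.orthogonal_orthogonal, hP]) hmem,
    Submodule.orthogonal_orthogonal, metric_pow_mul_of_isEffectiveDecomposition hη, sectional_sum,
    Finset.mul_sum, Nat.sub_add_cancel hr]

/-- The coefficient of `g^{r-i} ωᵢ` in the sum or difference of complementary curvatures. -/
def curvatureCoeff (n q r : ℕ) (ε : ℝ) (i : ℕ) : ℝ :=
  (-1) ^ i * (n - r - i)! / ((n - 2 * q - r)! * (r - i)!) + ε * ((r - 2 * q)! : ℝ)⁻¹

theorem pqCurvature_const_iff (hR : R ∈ bidegree V 2 2)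
    (hS : bianchi (stdOrthonormalBasis ℝ V : _ → V) (R ^ q) = 0) (hr : 2 * q ≤ r)
    (hrn : r + 2 * q ≤ finrank ℝ V) (hη : IsEffectiveDecomposition (2 * q) (R ^ q) η) (ε c : ℝ) :
    (∀ P : Submodule ℝ V, finrank ℝ P = r → sectional (pqTensor R r q) P +
      ε * sectional (pqTensor R (finrank ℝ V - r) q) Pᗮ = c) ↔
    (∀ i, 1 ≤ i → i ≤ 2 * q → curvatureCoeff (finrank ℝ V) q r ε i = 0 ∨ η i = 0) ∧
      (r ! * curvatureCoeff (finrank ℝ V) q r ε 0) • η 0 = algebraMap ℝ _ c := by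
  rw [← sectional_sum_eq_const_iff hr hrn hη.mem hη.effective
    (hη.bianchi_eq_zero (by omega) hS)]
  refine forall_congr' fun P => forall_congr' fun hP => ?_
  rw [sectional_pqTensor hR hr hrn hη hP, sectional_pqTensor_orthogonal hR hr hrn hη hP,
    Finset.mul_sum, ← Finset.sum_add_distrib, sectional_sum]
  refine Eq.congr_left (Finset.sum_congr rfl fun i _ => ?_)
  rw [sectional_smul, curvatureCoeff]
  ring

/-- The case `N = r = 2q` with all coefficients `1`, where the sum is `R^q` itself. -/
theorem sectional_pow_const_iff
    (hS : bianchi (stdOrthonormalBasis ℝ V : _ → V) (R ^ q) = 0)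
    (hq : 4 * q ≤ finrank ℝ V) (hη : IsEffectiveDecomposition (2 * q) (R ^ q) η) (c : ℝ) :
    (∀ P : Submodule ℝ V, finrank ℝ P = 2 * q → sectional (R ^ q) P = c) ↔
    (∀ i, 1 ≤ i → i ≤ 2 * q → η i = 0) ∧ ((2 * q)! : ℝ) • η 0 = algebraMap ℝ _ c := by
  have := sectional_sum_eq_const_iff (N := 2 * q) le_rfl (by omega) hη.mem hη.effective
    (hη.bianchi_eq_zero (by omega) hS) (fun _ => 1) c
  simpa only [one_smul, one_ne_zero, false_or, mul_one, ← hη.sum_eq] using this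

end Curvature

/-! ### Which coefficients vanish -/

section Coefficients

variable {n q r i : ℕ}

theorem strictMono_factorial_div {j : ℕ} (hj : 1 ≤ j) :
    StrictMono fun t : ℕ => ((t + j)! : ℝ) / t ! := by
  refine strictMono_nat_of_lt_succ fun t => ?_
  have h1 : (0 : ℝ) < t ! := by positivity
  have h2 : (0 : ℝ) < (t + j)! := by positivity
  have h3 : (1 : ℝ) ≤ j := by exact_mod_cast hj
  rw [show t + 1 + j = t + j + 1 by ring, Nat.factorial_succ, Nat.factorial_succ,
    div_lt_div_iff₀ h1 (by positivity)]
  push_cast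
  have : (0 : ℝ) < (t + j)! * t ! := by positivity
  nlinarith

/-- Both quotients become values of the same function `t ↦ (t+j)!/t!` with `j = 2q - i`, at `t = n -
2q - r` and `t = r - 2q`; these arguments agree exactly when `n = 2r`. -/
theorem factorial_mul_curvatureCoeff (hr : 2 * q ≤ r) (hrn : r + 2 * q ≤ n) (hi : i ≤ 2 * q)
    (ε : ℝ) : (r - i)! * curvatureCoeff n q r ε i =
      (-1) ^ i * ((n - 2 * q - r + (2 * q - i))! / (n - 2 * q - r)!) +
        ε * ((r - 2 * q + (2 * q - i))! / (r - 2 * q)!) := by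
  have h1 : ((r - i)! : ℝ) ≠ 0 := by positivity
  rw [curvatureCoeff, show n - 2 * q - r + (2 * q - i) = n - r - i by omega,
    show r - 2 * q + (2 * q - i) = r - i by omega]
  field_simp

theorem curvatureCoeff_eq_zero_iff (hr : 2 * q ≤ r) (hrn : r + 2 * q ≤ n) (hi : i ≤ 2 * q)
    (ε : ℝ) : curvatureCoeff n q r ε i = 0 ↔
      (-1) ^ i * ((n - 2 * q - r + (2 * q - i))! / (n - 2 * q - r)! : ℝ) +
        ε * ((r - 2 * q + (2 * q - i))! / (r - 2 * q)!) = 0 := by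
  rw [← factorial_mul_curvatureCoeff hr hrn hi]
  have h1 : ((r - i)! : ℝ) ≠ 0 := by positivity
  simp [h1]

theorem curvatureCoeff_neg_one_eq_zero_iff (hr : 2 * q ≤ r) (hrn : r + 2 * q ≤ n)
    (hi : i ≤ 2 * q) (hn : n ≠ 2 * r) : curvatureCoeff n q r (-1) i = 0 ↔ i = 2 * q := by
  rw [curvatureCoeff_eq_zero_iff hr hrn hi]
  have h1 : (0 : ℝ) < (n - 2 * q - r + (2 * q - i))! / (n - 2 * q - r)! := by positivity
  have h2 : (0 : ℝ) < (r - 2 * q + (2 * q - i))! / (r - 2 * q)! := by positivity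
  constructor
  · intro h
    by_contra hne
    have hj : 1 ≤ 2 * q - i := by omega
    rcases Nat.even_or_odd i with he | ho
    · rw [he.neg_one_pow] at h
      have := (strictMono_factorial_div hj).injective (a₁ := n - 2 * q - r) (a₂ := r - 2 * q)
        (by linarith)
      omega
    · rw [ho.neg_one_pow] at h
      linarith
  -- At `i = 2q` both quotients are `1` and the sign is even, so the difference does not detect the
  -- top component.
  · rintro rfl
    have h3 : ((n - 2 * q - r)! : ℝ) ≠ 0 := by positivity
    have h4 : ((r - 2 * q)! : ℝ) ≠ 0 := by positivity
    simp [h3, h4]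

theorem curvatureCoeff_one_ne_zero (hr : 2 * q ≤ r) (hrn : r + 2 * q ≤ n)
    (hi : i ≤ 2 * q) (hn : n ≠ 2 * r) : curvatureCoeff n q r 1 i ≠ 0 := by
  rw [Ne, curvatureCoeff_eq_zero_iff hr hrn hi]
  have h1 : (0 : ℝ) < (n - 2 * q - r + (2 * q - i))! / (n - 2 * q - r)! := by positivity
  have h2 : (0 : ℝ) < (r - 2 * q + (2 * q - i))! / (r - 2 * q)! := by positivity
  intro h
  rcases Nat.even_or_odd i with he | ho
  · rw [he.neg_one_pow] at h
    linarith
  · rw [ho.neg_one_pow] at h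
    -- An odd index differs from `2q`, so strict monotonicity is available.
    have hj : 1 ≤ 2 * q - i := by obtain ⟨k, rfl⟩ := ho; omega
    have := (strictMono_factorial_div hj).injective (a₁ := n - 2 * q - r) (a₂ := r - 2 * q)
      (by linarith)
    omega

theorem curvatureCoeff_two_mul_eq_zero_iff (hr : 2 * q ≤ r) (hi : i ≤ 2 * q) (ε : ℝ) :
    curvatureCoeff (2 * r) q r ε i = 0 ↔ (-1) ^ i + ε = 0 := by
  rw [curvatureCoeff_eq_zero_iff hr (by omega) hi, show 2 * r - 2 * q - r = r - 2 * q by omega,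
    ← add_mul]
  have h2 : ((r - 2 * q + (2 * q - i))! / (r - 2 * q)! : ℝ) ≠ 0 := by positivity
  simp [h2]

theorem factorial_mul_curvatureCoeff_zero (hr : 2 * q ≤ r) (hrn : r + 2 * q ≤ n) (ε : ℝ) :
    r ! * curvatureCoeff n q r ε 0 =
      (n - r)! / (n - 2 * q - r)! + ε * (r ! / (r - 2 * q)!) := by
  have := factorial_mul_curvatureCoeff hr hrn (Nat.zero_le _) ε
  rwa [Nat.sub_zero, Nat.sub_zero, Nat.sub_add_cancel hr, pow_zero, one_mul,
    show n - 2 * q - r + 2 * q = n - r by omega] at this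

end Coefficients

end DoubleForms

end

noncomputable section

namespace RiemannCurv

open scoped Topology

/-! ### Symmetries of the curvature tensor of a metric on a vector space -/

section SecondDerivative

variable {E F : Type*} [NormedAddCommGroup E] [NormedSpace ℝ E] [NormedAddCommGroup F]
  [NormedSpace ℝ F] {f : E → F} {a : E}

/-- The second derivative of a map between vector spaces. -/
def secondDeriv (f : E → F) (a : E) : E →L[ℝ] E →L[ℝ] F := fderiv ℝ (fderiv ℝ f) a

/-- Linear symmetries of the values pass to the derivative. At points of non-differentiability the
default value `0` keeps this true. -/
theorem clm_fderiv_eq {L L' : F →L[ℝ] ℝ} (h : ∀ y, L (f y) = L' (f y)) (y w : E) :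
    L (fderiv ℝ f y w) = L' (fderiv ℝ f y w) := by
  by_cases hf : DifferentiableAt ℝ f y
  · have h1 := L.hasFDerivAt.comp y hf.hasFDerivAt
    have h2 := L'.hasFDerivAt.comp y hf.hasFDerivAt
    rw [show L ∘ f = L' ∘ f from funext h] at h1
    exact DFunLike.congr_fun (h1.unique h2) w
  · simp [fderiv_zero_of_not_differentiableAt hf]

theorem differentiableAt_fderiv (hf : ContDiffAt ℝ 2 f a) : DifferentiableAt ℝ (fderiv ℝ f) a :=
  (hf.fderiv_right (m := 1) (by norm_num)).differentiableAt one_ne_zero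

theorem hasFDerivAt_clm_fderiv (hf : ContDiffAt ℝ 2 f a) (L : F →L[ℝ] ℝ) (v : E) :
    HasFDerivAt (fun y => L (fderiv ℝ f y v)) (L ∘L (secondDeriv f a).flip v) a := by
  have h := L.hasFDerivAt.comp a
    ((differentiableAt_fderiv hf).hasFDerivAt.clm_apply (hasFDerivAt_const v a))
  refine h.congr_fderiv ?_
  ext z
  simp [secondDeriv]

theorem differentiableAt_clm_fderiv {H : Type*} [NormedAddCommGroup H] [NormedSpace ℝ H]
    (hf : ContDiffAt ℝ 2 f a) (L : F →L[ℝ] H) (v : E) :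
    DifferentiableAt ℝ (fun y => L (fderiv ℝ f y v)) a :=
  L.differentiableAt.comp a
    ((differentiableAt_fderiv hf).clm_apply (differentiableAt_const v))

theorem differentiableAt_clm_comp_fderiv (hf : ContDiffAt ℝ 2 f a) (L : F →L[ℝ] ℝ) :
    DifferentiableAt ℝ (fun y => L ∘L fderiv ℝ f y) a :=
  (differentiableAt_const L).clm_comp (differentiableAt_fderiv hf)

theorem secondDeriv_symm (hf : ContDiffAt ℝ 2 f a) (u v : E) :
    secondDeriv f a u v = secondDeriv f a v u :=
  hf.isSymmSndFDerivAt (by simp) u v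

theorem clm_secondDeriv_eq (hf : ContDiffAt ℝ 2 f a) {L L' : F →L[ℝ] ℝ}
    (h : ∀ y, L (f y) = L' (f y)) (u v : E) :
    L (secondDeriv f a u v) = L' (secondDeriv f a u v) := by
  have h1 := hasFDerivAt_clm_fderiv hf L v
  simp only [clm_fderiv_eq h] at h1
  exact DFunLike.congr_fun (h1.unique (hasFDerivAt_clm_fderiv hf L' v)) u

end SecondDerivative

/-! ### Christoffel symbols, the cyclic identity and metric compatibility -/

section Local

set_option synthInstance.maxHeartbeats 400000
set_option maxHeartbeats 1000000

variable {E : Type*} [NormedAddCommGroup E] [NormedSpace ℝ E] {G : E → E →L[ℝ] E →L[ℝ] ℝ} {a : E}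

/-- Evaluation of a bilinear form at a pair of vectors. -/
def evalAt (u v : E) : (E →L[ℝ] E →L[ℝ] ℝ) →L[ℝ] ℝ :=
  ContinuousLinearMap.apply ℝ ℝ v ∘L ContinuousLinearMap.apply ℝ (E →L[ℝ] ℝ) u

theorem fderiv_symm (hG : ∀ y u v, G y u v = G y v u) (y w u v : E) :
    fderiv ℝ G y w u v = fderiv ℝ G y w v u :=
  clm_fderiv_eq (F := E →L[ℝ] E →L[ℝ] ℝ) (f := G) (L := evalAt u v) (L' := evalAt v u)
    (fun y => hG y u v) y w

theorem christoffelFirst_apply (y u v w : E) : christoffelFirst G y u v w =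
    (1 / 2 : ℝ) * (fderiv ℝ G y u v w + fderiv ℝ G y v u w - fderiv ℝ G y w u v) := by
  simp [christoffelFirst]

theorem christoffel_symm (hG : ∀ y u v, G y u v = G y v u) (y u v : E) :
    christoffel G y u v = christoffel G y v u := by
  unfold christoffel
  congr 1
  ext w
  rw [christoffelFirst_apply, christoffelFirst_apply, fderiv_symm hG y w u v]
  ring

/-- By the symmetry of the Christoffel symbols, both the derivative terms and the quadratic terms
cancel in pairs. -/
theorem curvatureOperator_cyclic (hG : ∀ y u v, G y u v = G y v u) (y u v w : E) :
    curvatureOperator G y u v w + curvatureOperator G y v w u + curvatureOperator G y w u v = 0 := by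
  have h : ∀ u v, (fun z => christoffel G z u v) = fun z => christoffel G z v u := fun u v =>
    funext fun z => christoffel_symm hG z u v
  simp only [curvatureOperator]
  rw [h w u, h w v, h v u, christoffel_symm hG y w u, christoffel_symm hG y w v,
    christoffel_symm hG y v u]
  abel

theorem metric_christoffel {y : E} (hy : (G y).IsInvertible) (u v : E) :
    G y (christoffel G y u v) = christoffelFirst G y u v :=
  hy.self_apply_inverse _

theorem christoffelFirst_eq (y u v : E) : christoffelFirst G y u v = (1 / 2 : ℝ) •
    (ContinuousLinearMap.apply ℝ (E →L[ℝ] ℝ) v (fderiv ℝ G y u) +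
      ContinuousLinearMap.apply ℝ (E →L[ℝ] ℝ) u (fderiv ℝ G y v) -
      evalAt u v ∘L fderiv ℝ G y) := rfl

theorem differentiableAt_christoffelFirst (hG2 : ContDiffAt ℝ 2 G a) (u v : E) :
    DifferentiableAt ℝ (fun y => christoffelFirst G y u v) a := by
  simp only [christoffelFirst_eq]
  exact (((differentiableAt_clm_fderiv hG2 _ u).add (differentiableAt_clm_fderiv hG2 _ v)).sub
    (differentiableAt_clm_comp_fderiv hG2 _)).const_smul (1 / 2 : ℝ)

theorem fderiv_christoffelFirst (hG2 : ContDiffAt ℝ 2 G a) (u v w t : E) :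
    fderiv ℝ (fun y => christoffelFirst G y v w) a u t = (1 / 2 : ℝ) *
      (evalAt w t (secondDeriv G a u v) + evalAt v t (secondDeriv G a u w) -
        evalAt v w (secondDeriv G a u t)) := by
  have h4 := (differentiableAt_christoffelFirst hG2 v w).hasFDerivAt.clm_apply
    (hasFDerivAt_const t a)
  simp only [christoffelFirst_apply] at h4
  have h5 := (((hasFDerivAt_clm_fderiv hG2 (evalAt w t) v).add
    (hasFDerivAt_clm_fderiv hG2 (evalAt v t) w)).sub
      (hasFDerivAt_clm_fderiv hG2 (evalAt v w) t)).const_mul (1 / 2 : ℝ)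
  have h6 := DFunLike.congr_fun (h4.unique h5) u
  simpa using h6

variable [CompleteSpace E]

theorem eventually_isInvertible (hGc : ContinuousAt G a) (ha : (G a).IsInvertible) :
    ∀ᶠ y in 𝓝 a, (G y).IsInvertible := by
  obtain ⟨e, he⟩ := ha
  have := hGc.eventually (he ▸ ContinuousLinearEquiv.nhds e)
  filter_upwards [this] with y hy
  obtain ⟨f, hf⟩ := hy
  exact ⟨f, hf⟩

theorem differentiableAt_christoffel (hG2 : ContDiffAt ℝ 2 G a) (ha : (G a).IsInvertible)
    (u v : E) : DifferentiableAt ℝ (fun y => christoffel G y u v) a := by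
  have h : DifferentiableAt ℝ (fun y => (G y).inverse) a :=
    ((ha.contDiffAt_map_inverse (n := 1)).differentiableAt one_ne_zero).comp a
      (hG2.differentiableAt two_ne_zero)
  exact h.clm_apply (differentiableAt_christoffelFirst hG2 u v)

/-- Differentiate `G (Γ(v, w)) = christoffelFirst`, valid near `a` where `G` stays invertible, and
rewrite the derivative of `G` by metric compatibility (`h4`). The inverse metric never has to be
differentiated explicitly. -/
theorem metric_fderiv_christoffel (hG : ∀ y u v, G y u v = G y v u) (hG2 : ContDiffAt ℝ 2 G a)
    (ha : (G a).IsInvertible) (u v w t : E) :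
    G a (fderiv ℝ (fun y => christoffel G y v w) a u) t = (1 / 2 : ℝ) *
      (evalAt w t (secondDeriv G a u v) + evalAt v t (secondDeriv G a u w) -
        evalAt v w (secondDeriv G a u t)) -
      G a (christoffel G a u (christoffel G a v w)) t -
      G a (christoffel G a u t) (christoffel G a v w) := by
  have h1 := (hG2.differentiableAt two_ne_zero).hasFDerivAt.clm_apply
    (differentiableAt_christoffel hG2 ha v w).hasFDerivAt
  have h2 : (fun y => G y (christoffel G y v w)) =ᶠ[𝓝 a] fun y => christoffelFirst G y v w := by
    filter_upwards [eventually_isInvertible hG2.continuousAt ha] with y hy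
    exact metric_christoffel hy v w
  have h3 := congrArg (fun L : E →L[ℝ] E →L[ℝ] ℝ => L u t)
    ((h1.congr_of_eventuallyEq h2.symm).fderiv)
  simp only [fderiv_christoffelFirst hG2] at h3
  have h4 : fderiv ℝ G a u (christoffel G a v w) t =
      G a (christoffel G a u (christoffel G a v w)) t +
        G a (christoffel G a u t) (christoffel G a v w) := by
    rw [metric_christoffel ha, metric_christoffel ha, christoffelFirst_apply,
      christoffelFirst_apply, fderiv_symm hG a u t, fderiv_symm hG a t u]
    ring
  rw [h3]
  simp [h4]
  ring

/-- The iterated terms `Γ(u, Γ(v, w))` cancel. Second derivatives of `G` and the products `G(Γ(u,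
t), Γ(v, w))` remain, and these are skew in `w, t` by the symmetries of `G` and of second
derivatives. -/
theorem metric_curvatureOperator_skew (hG : ∀ y u v, G y u v = G y v u)
    (hG2 : ContDiffAt ℝ 2 G a) (ha : (G a).IsInvertible) (u v w t : E) :
    G a (curvatureOperator G a u v w) t = -G a (curvatureOperator G a u v t) w := by
  have hs : ∀ p q s s', evalAt s s' (secondDeriv G a p q) =
      evalAt s' s (secondDeriv G a p q) := fun p q s s' =>
    clm_secondDeriv_eq hG2 (fun y => hG y s s') p q
  simp only [curvatureOperator, map_add, map_sub, add_apply, sub_apply,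
    metric_fderiv_christoffel hG hG2 ha]
  rw [secondDeriv_symm hG2 v u, hs u v t w, hs u w v t, hs u t v w, hs v w u t, hs v t u w,
    hG a (christoffel G a u t), hG a (christoffel G a v t)]
  ring

end Local

/-! ### Symmetries of the Riemann tensor -/

section Manifold

set_option linter.unusedSectionVars false

variable {E : Type*} [NormedAddCommGroup E] [NormedSpace ℝ E]
  {M : Type*} [TopologicalSpace M] [ChartedSpace E M] [IsManifold 𝓘(ℝ, E) ∞ M]
  [RiemannianBundle (fun x : M => TangentSpace 𝓘(ℝ, E) x)]

theorem metricInChart_symm (m : M) (y u v : E) :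
    metricInChart m y u v = metricInChart m y v u :=
  real_inner_comm (F := TangentSpace 𝓘(ℝ, E) ((extChartAt 𝓘(ℝ, E) m).symm y)) _ _

theorem riemann_cyclic (m : M) (x y z w : TangentSpace 𝓘(ℝ, E) m) :
    riemann m x y z w + riemann m y w z x + riemann m w x z y = 0 := by
  simp only [riemann]
  rw [← add_apply, ← add_apply, ← map_add, ← map_add,
    curvatureOperator_cyclic (metricInChart_symm m), map_zero, zero_apply]

theorem extChartAt_symm_mem_baseSet (m : M) {y : E} (hy : y ∈ (extChartAt 𝓘(ℝ, E) m).target) :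
    (extChartAt 𝓘(ℝ, E) m).symm y ∈
      (trivializationAt E (TangentSpace 𝓘(ℝ, E)) m).baseSet := by
  have := (extChartAt 𝓘(ℝ, E) m).map_target hy
  rwa [extChartAt_source] at this

theorem metricInChart_self_pos (m : M) {u : E} (hu : u ≠ 0) :
    0 < metricInChart (E := E) m (extChartAt 𝓘(ℝ, E) m m) u u := by
  set a := extChartAt 𝓘(ℝ, E) m m with ha
  have hb := extChartAt_symm_mem_baseSet m (mem_extChartAt_target (I := 𝓘(ℝ, E)) m)
  refine real_inner_self_pos
    (F := TangentSpace 𝓘(ℝ, E) ((extChartAt 𝓘(ℝ, E) m).symm a)).2 fun h => hu ?_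
  rw [← (trivializationAt E (TangentSpace 𝓘(ℝ, E)) m).continuousLinearMapAt_symmL (R := ℝ) hb u]
  exact (congrArg _ h).trans (map_zero _)

variable [FiniteDimensional ℝ E]

/-- Positive definiteness gives injectivity into the dual, which has the same finite dimension. -/
theorem isInvertible_metricInChart (m : M) :
    (metricInChart (E := E) m (extChartAt 𝓘(ℝ, E) m m)).IsInvertible := by
  have hinj : Function.Injective (metricInChart (E := E) m (extChartAt 𝓘(ℝ, E) m m)) := by
    refine (injective_iff_map_eq_zero _).2 fun u hu => ?_
    by_contra h
    exact (metricInChart_self_pos m h).ne' (by rw [hu]; rfl)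
  have hdim : finrank ℝ E = finrank ℝ (E →L[ℝ] ℝ) := by
    rw [← Subspace.dual_finrank_eq]
    exact (LinearMap.toContinuousLinearMap (𝕜 := ℝ) (E := E) (F' := ℝ)).finrank_eq
  exact ⟨(LinearEquiv.ofInjectiveOfFinrankEq _ hinj hdim).toContinuousLinearEquiv, rfl⟩

variable [IsContMDiffRiemannianBundle 𝓘(ℝ, E) ∞ E (fun x : M => TangentSpace 𝓘(ℝ, E) x)]

theorem contMDiffOn_symmL_extChartAt_symm (m : M) (u : E) :
    ContMDiffOn 𝓘(ℝ, E) (𝓘(ℝ, E).prod 𝓘(ℝ, E)) ∞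
      (fun y => (TotalSpace.mk' E ((extChartAt 𝓘(ℝ, E) m).symm y)
        ((trivializationAt E (TangentSpace 𝓘(ℝ, E)) m).symmL ℝ
          ((extChartAt 𝓘(ℝ, E) m).symm y) u) : TotalSpace E (TangentSpace 𝓘(ℝ, E) (M := M))))
      (extChartAt 𝓘(ℝ, E) m).target := by
  have h := ((trivializationAt E (TangentSpace 𝓘(ℝ, E)) m).contMDiffOn_symm (IB := 𝓘(ℝ, E))
    (n := ∞)).comp ((contMDiffOn_extChartAt_symm (I := 𝓘(ℝ, E)) (n := ∞) m).prodMk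
      (contMDiffOn_const (c := u))) fun y hy => by
        rw [Set.mem_preimage, Trivialization.mem_target]
        exact extChartAt_symm_mem_baseSet m hy
  refine h.congr fun y hy => ?_
  have hb := extChartAt_symm_mem_baseSet m hy
  rw [Trivialization.symmL_apply _ hb]
  exact Trivialization.mk_symm _ hb u

theorem contDiffAt_metricInChart (m : M) :
    ContDiffAt ℝ 2 (metricInChart (E := E) m) (extChartAt 𝓘(ℝ, E) m m) := by
  refine ContDiffOn.contDiffAt (s := (extChartAt 𝓘(ℝ, E) m).target) ?_
    (extChartAt_target_mem_nhds m)
  rw [contDiffOn_clm_apply]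
  intro u
  rw [contDiffOn_clm_apply]
  intro v
  have h := ContMDiffOn.inner_bundle (IB := 𝓘(ℝ, E)) (F := E) (n := ∞)
    (E := fun x : M => TangentSpace 𝓘(ℝ, E) x) (b := (extChartAt 𝓘(ℝ, E) m).symm)
    (v := fun y => (trivializationAt E (TangentSpace 𝓘(ℝ, E)) m).symmL ℝ _ u)
    (w := fun y => (trivializationAt E (TangentSpace 𝓘(ℝ, E)) m).symmL ℝ _ v)
    (contMDiffOn_symmL_extChartAt_symm m u) (contMDiffOn_symmL_extChartAt_symm m v)
  exact (contMDiffOn_iff_contDiffOn.1 h).of_le (WithTop.coe_le_coe.2 le_top)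

theorem riemann_skew (m : M) (x y z w : TangentSpace 𝓘(ℝ, E) m) :
    riemann m x y z w = -riemann m x y w z := by
  have := FiniteDimensional.complete ℝ E
  exact metric_curvatureOperator_skew (metricInChart_symm m) (contDiffAt_metricInChart m)
    (isInvertible_metricInChart m) _ _ _ _

end Manifold

end RiemannCurv

end

noncomputable section

namespace RiemannCurv

/-! ### Constancy of combinations of `(p, q)`-curvatures -/

section Pointwise

set_option linter.unusedSectionVars false

open DoubleForms

variable {E : Type*} [NormedAddCommGroup E] [NormedSpace ℝ E] [FiniteDimensional ℝ E]
  {M : Type*} [TopologicalSpace M] [ChartedSpace E M] [IsManifold 𝓘(ℝ, E) ∞ M]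
  [RiemannianBundle (fun x : M => TangentSpace 𝓘(ℝ, E) x)]
  [IsContMDiffRiemannianBundle 𝓘(ℝ, E) ∞ E (fun x : M => TangentSpace 𝓘(ℝ, E) x)]
  {n q r : ℕ} {m : M} {η : ℕ → DForm (TangentSpace 𝓘(ℝ, E) m)}

theorem exists_isEffectiveDecomposition_riemannForm_pow (hq : 4 * q ≤ finrank ℝ E) (m : M) :
    ∃ η : ℕ → DForm (TangentSpace 𝓘(ℝ, E) m),
      IsEffectiveDecomposition (2 * q) (riemannForm E m ^ q) η :=
  exists_isEffectiveDecomposition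
    (show 2 * (2 * q) ≤ finrank ℝ E by omega) (pow_mem_bidegree (ofTensor_mem _) q)

theorem pqCurvature_riemann_const_iff (hn : finrank ℝ E = n) (hr : 2 * q ≤ r) (hrn : r + 2 * q ≤ n)
    (hη : IsEffectiveDecomposition (2 * q) (riemannForm E m ^ q) η) (ε c : ℝ) :
    (∀ P : Submodule ℝ (TangentSpace 𝓘(ℝ, E) m), finrank ℝ P = r →
      pqCurvature E r q m P + ε * pqCurvature E (n - r) q m Pᗮ = c) ↔
    (∀ i, 1 ≤ i → i ≤ 2 * q → curvatureCoeff n q r ε i = 0 ∨ η i = 0) ∧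
      ((n - r)! / (n - 2 * q - r)! + ε * (r ! / (r - 2 * q)!) : ℝ) • η 0 = algebraMap ℝ _ c := by
  subst hn
  rw [← factorial_mul_curvatureCoeff_zero hr hrn]
  exact pqCurvature_const_iff (ofTensor_mem _)
    (bianchi_ofTensor_pow (riemann_skew m) (riemann_cyclic m) q) hr hrn hη ε c

theorem sectional_riemannForm_pow_const_iff (hq : 4 * q ≤ finrank ℝ E)
    (hη : IsEffectiveDecomposition (2 * q) (riemannForm E m ^ q) η) (c : ℝ) :
    (∀ P : Submodule ℝ (TangentSpace 𝓘(ℝ, E) m), finrank ℝ P = 2 * q →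
      sectional (riemannForm E m ^ q) P = c) ↔
    (∀ i, 1 ≤ i → i ≤ 2 * q → η i = 0) ∧ ((2 * q)! : ℝ) • η 0 = algebraMap ℝ _ c :=
  sectional_pow_const_iff (bianchi_ofTensor_pow (riemann_skew m) (riemann_cyclic m) q) hq hη c

theorem pqCurvature_sub_const_iff (hn : finrank ℝ E = n) (hr : 2 * q ≤ r) (hrn : r + 2 * q ≤ n)
    (h : n ≠ 2 * r) (hη : IsEffectiveDecomposition (2 * q) (riemannForm E m ^ q) η) (c : ℝ) :
    (∀ P : Submodule ℝ (TangentSpace 𝓘(ℝ, E) m), finrank ℝ P = r →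
      pqCurvature E r q m P - pqCurvature E (n - r) q m Pᗮ = c) ↔
    (∀ i, 1 ≤ i → i ≤ 2 * q - 1 → η i = 0) ∧
      ((n - r)! / (n - 2 * q - r)! - r ! / (r - 2 * q)! : ℝ) • η 0 = algebraMap ℝ _ c := by
  have key := pqCurvature_riemann_const_iff hn hr hrn hη (-1) c
  simp only [neg_one_mul, ← sub_eq_add_neg] at key
  rw [key]
  refine and_congr_left' (forall_congr' fun i => forall_congr' fun h1 => ?_)
  constructor
  · intro H hi
    exact (H (by omega)).resolve_left
      fun h0 => by have := (curvatureCoeff_neg_one_eq_zero_iff hr hrn (by omega) h).1 h0; omega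
  · intro H hi
    rcases hi.eq_or_lt with h2 | h2
    · exact Or.inl ((curvatureCoeff_neg_one_eq_zero_iff hr hrn hi h).2 h2)
    · exact Or.inr (H (by omega))

theorem pqCurvature_add_const_iff (hn : finrank ℝ E = n) (hr : 2 * q ≤ r) (hrn : r + 2 * q ≤ n)
    (h : n ≠ 2 * r) (hη : IsEffectiveDecomposition (2 * q) (riemannForm E m ^ q) η) (c : ℝ) :
    (∀ P : Submodule ℝ (TangentSpace 𝓘(ℝ, E) m), finrank ℝ P = r →
      pqCurvature E r q m P + pqCurvature E (n - r) q m Pᗮ = c) ↔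
    (∀ i, 1 ≤ i → i ≤ 2 * q → η i = 0) ∧
      ((n - r)! / (n - 2 * q - r)! + r ! / (r - 2 * q)! : ℝ) • η 0 = algebraMap ℝ _ c := by
  have key := pqCurvature_riemann_const_iff hn hr hrn hη 1 c
  simp only [one_mul] at key
  rw [key]
  refine and_congr_left' (forall_congr' fun i => forall_congr' fun h1 => forall_congr' fun hi => ?_)
  exact or_iff_right (curvatureCoeff_one_ne_zero hr hrn hi h)

/-- Both conditions kill all `η i` with `i ≥ 1` and prescribe a multiple of `η 0`; the constant on
the left is `c` times the ratio of the two multiples, which is positive. -/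
theorem pqCurvature_add_const_iff_sectional (hn : finrank ℝ E = n) (hr : 2 * q ≤ r)
    (hrn : r + 2 * q ≤ n) (h : n ≠ 2 * r)
    (hη : IsEffectiveDecomposition (2 * q) (riemannForm E m ^ q) η) (c : ℝ) :
    (∀ P : Submodule ℝ (TangentSpace 𝓘(ℝ, E) m), finrank ℝ P = r →
      pqCurvature E r q m P + pqCurvature E (n - r) q m Pᗮ =
        ((n - r)! / (n - 2 * q - r)! + r ! / (r - 2 * q)!) / (2 * q)! * c) ↔
    ∀ P : Submodule ℝ (TangentSpace 𝓘(ℝ, E) m), finrank ℝ P = 2 * q →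
      sectional (riemannForm E m ^ q) P = c := by
  rw [pqCurvature_add_const_iff hn hr hrn h hη,
    sectional_riemannForm_pow_const_iff (by omega) hη]
  refine and_congr_right' ?_
  have h1 : (((n - r)! / (n - 2 * q - r)! + r ! / (r - 2 * q)! : ℝ) / (2 * q)!) ≠ 0 := by positivity
  have h2 : ((n - r)! / (n - 2 * q - r)! + r ! / (r - 2 * q)! : ℝ) =
      ((n - r)! / (n - 2 * q - r)! + r ! / (r - 2 * q)! : ℝ) / (2 * q)! * (2 * q)! :=
    (div_mul_cancel₀ _ (by positivity)).symm
  conv_lhs => lhs; rw [h2, mul_smul]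
  rw [Algebra.algebraMap_eq_smul_one, Algebra.algebraMap_eq_smul_one, mul_smul]
  exact smul_right_inj h1

theorem pqCurvature_half_sub_const_iff (hr : 2 * q ≤ r) (hn : finrank ℝ E = 2 * r)
    (hη : IsEffectiveDecomposition (2 * q) (riemannForm E m ^ q) η) (c : ℝ) :
    (∀ P : Submodule ℝ (TangentSpace 𝓘(ℝ, E) m), finrank ℝ P = r →
      pqCurvature E r q m P - pqCurvature E r q m Pᗮ = c) ↔
    (∀ i, 1 ≤ i → i ≤ 2 * q - 1 → Odd i → η i = 0) ∧ c = 0 := by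
  have key := pqCurvature_riemann_const_iff hn hr (by omega) hη (-1) c
  simp only [neg_one_mul, ← sub_eq_add_neg] at key
  rw [show 2 * r - r = r by omega, show 2 * r - 2 * q - r = r - 2 * q by omega, sub_self,
    zero_smul] at key
  rw [key]
  refine and_congr (forall_congr' fun i => forall_congr' fun h1 => ?_) ?_
  · constructor
    · intro H hi ho
      refine (H (by omega)).resolve_left fun h0 => ?_
      rw [curvatureCoeff_two_mul_eq_zero_iff hr (by omega), ho.neg_one_pow] at h0
      norm_num at h0
    · intro H hi
      rcases Nat.even_or_odd i with he | ho
      · left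
        rw [curvatureCoeff_two_mul_eq_zero_iff hr hi, he.neg_one_pow, add_neg_cancel]
      · exact Or.inr (H (by obtain ⟨k, rfl⟩ := ho; omega) ho)
  · rw [eq_comm]
    exact map_eq_zero_iff _ algebraMap_dform_injective

theorem pqCurvature_half_add_const_iff (hr : 2 * q ≤ r) (hn : finrank ℝ E = 2 * r)
    (hη : IsEffectiveDecomposition (2 * q) (riemannForm E m ^ q) η) (c : ℝ) :
    (∀ P : Submodule ℝ (TangentSpace 𝓘(ℝ, E) m), finrank ℝ P = r →
      pqCurvature E r q m P + pqCurvature E r q m Pᗮ = c) ↔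
    (∀ i, 2 ≤ i → i ≤ 2 * q → Even i → η i = 0) ∧
      (2 * r ! / (r - 2 * q)! : ℝ) • η 0 = algebraMap ℝ _ c := by
  have key := pqCurvature_riemann_const_iff hn hr (by omega) hη 1 c
  simp only [one_mul] at key
  rw [show 2 * r - r = r by omega, show 2 * r - 2 * q - r = r - 2 * q by omega, ← two_mul,
    ← mul_div_assoc] at key
  rw [key]
  refine and_congr_left' (forall_congr' fun i => ?_)
  constructor
  · intro H h1 hi he
    refine (H (by omega) hi).resolve_left fun h0 => ?_
    rw [curvatureCoeff_two_mul_eq_zero_iff hr hi, he.neg_one_pow] at h0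
    norm_num at h0
  · intro H h1 hi
    rcases Nat.even_or_odd i with he | ho
    · exact Or.inr (H (by obtain ⟨k, rfl⟩ := he; omega) hi he)
    · left
      rw [curvatureCoeff_two_mul_eq_zero_iff hr hi, ho.neg_one_pow, neg_add_cancel]

end Pointwise

end RiemannCurv

end

/-! ### From single points to the set `S` -/

theorem mainTheorem10 {E : Type*} [NormedAddCommGroup E] [NormedSpace ℝ E] [FiniteDimensional ℝ E]
    {M : Type*} [TopologicalSpace M] [ChartedSpace E M] [IsManifold 𝓘(ℝ, E) ∞ M]
    [RiemannianBundle (fun x : M => TangentSpace 𝓘(ℝ, E) x)]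
    [IsContMDiffRiemannianBundle 𝓘(ℝ, E) ∞ E (fun x : M => TangentSpace 𝓘(ℝ, E) x)]
    (n q r : ℕ) (hn : Module.finrank ℝ E = n) (hq : 1 ≤ q) (hr : 2 * q ≤ r) (hrn : r + 2 * q ≤ n) :
    -- the decomposition of `R^q` exists at every point
    (∀ m : M, ∃ η : ℕ → DoubleForms.DForm (TangentSpace 𝓘(ℝ, E) m),
      DoubleForms.IsEffectiveDecomposition (2 * q) (RiemannCurv.riemannForm E m ^ q) η) ∧
    ∀ η : (m : M) → ℕ → DoubleForms.DForm (TangentSpace 𝓘(ℝ, E) m),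
      (∀ m, DoubleForms.IsEffectiveDecomposition (2 * q) (RiemannCurv.riemannForm E m ^ q) (η m)) →
    -- `S = univ` is the case of the whole manifold, `S = {m}` the case of a single point
    ∀ S : Set M, S.Nonempty →
      (n ≠ 2 * r →
        (∀ c : ℝ,
          (∀ m ∈ S, ∀ P : Submodule ℝ (TangentSpace 𝓘(ℝ, E) m), Module.finrank ℝ P = r →
            RiemannCurv.pqCurvature E r q m P - RiemannCurv.pqCurvature E (n - r) q m Pᗮ = c) ↔
          ∀ m ∈ S, (∀ i, 1 ≤ i → i ≤ 2 * q - 1 → η m i = 0) ∧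
            (((n - r)! : ℝ) / ((n - 2 * q - r)! : ℝ) - (r ! : ℝ) / ((r - 2 * q)! : ℝ)) • η m 0
              = algebraMap ℝ _ c) ∧
        (∀ c : ℝ,
          (∀ m ∈ S, ∀ P : Submodule ℝ (TangentSpace 𝓘(ℝ, E) m), Module.finrank ℝ P = r →
            RiemannCurv.pqCurvature E r q m P + RiemannCurv.pqCurvature E (n - r) q m Pᗮ = c) ↔
          ∀ m ∈ S, (∀ i, 1 ≤ i → i ≤ 2 * q → η m i = 0) ∧
            (((n - r)! : ℝ) / ((n - 2 * q - r)! : ℝ) + (r ! : ℝ) / ((r - 2 * q)! : ℝ)) • η m 0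
              = algebraMap ℝ _ c) ∧
        ((∃ c : ℝ, ∀ m ∈ S, ∀ P : Submodule ℝ (TangentSpace 𝓘(ℝ, E) m),
            Module.finrank ℝ P = r →
            RiemannCurv.pqCurvature E r q m P + RiemannCurv.pqCurvature E (n - r) q m Pᗮ = c) ↔
          ∃ κ : ℝ, ∀ m ∈ S, ∀ P : Submodule ℝ (TangentSpace 𝓘(ℝ, E) m),
            Module.finrank ℝ P = 2 * q →
            DoubleForms.sectional (RiemannCurv.riemannForm E m ^ q) P = κ)) ∧
      (n = 2 * r →
        (∀ c : ℝ,
          (∀ m ∈ S, ∀ P : Submodule ℝ (TangentSpace 𝓘(ℝ, E) m), Module.finrank ℝ P = r →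
            RiemannCurv.pqCurvature E r q m P - RiemannCurv.pqCurvature E r q m Pᗮ = c) ↔
          (∀ m ∈ S, ∀ i, 1 ≤ i → i ≤ 2 * q - 1 → Odd i → η m i = 0) ∧ c = 0) ∧
        (∀ c : ℝ,
          (∀ m ∈ S, ∀ P : Submodule ℝ (TangentSpace 𝓘(ℝ, E) m), Module.finrank ℝ P = r →
            RiemannCurv.pqCurvature E r q m P + RiemannCurv.pqCurvature E r q m Pᗮ = c) ↔
          ∀ m ∈ S, (∀ i, 2 ≤ i → i ≤ 2 * q → Even i → η m i = 0) ∧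
            (2 * (r ! : ℝ) / ((r - 2 * q)! : ℝ)) • η m 0 = algebraMap ℝ _ c)) := by
  refine ⟨RiemannCurv.exists_isEffectiveDecomposition_riemannForm_pow (by omega),
    fun η hη S hS => ⟨fun h => ⟨fun c => ?_, fun c => ?_, ?_⟩, fun h => ⟨fun c => ?_, fun c => ?_⟩⟩⟩
  · exact forall₂_congr fun m _ => RiemannCurv.pqCurvature_sub_const_iff hn hr hrn h (hη m) c
  · exact forall₂_congr fun m _ => RiemannCurv.pqCurvature_add_const_iff hn hr hrn h (hη m) c
  -- The rescaling between the two constants does not depend on the point, so one constant serves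
  -- for all of `S`.
  · have hsurj : Function.Surjective fun c : ℝ =>
        ((n - r)! / (n - 2 * q - r)! + r ! / (r - 2 * q)! : ℝ) / (2 * q)! * c :=
      mul_left_surjective₀ (by positivity)
    rw [hsurj.exists]
    exact exists_congr fun c => forall₂_congr fun m _ =>
      RiemannCurv.pqCurvature_add_const_iff_sectional hn hr hrn h (hη m) c
  · subst h
    -- The condition `c = 0` stands outside the quantifier over `S`, so a point is needed to extract
    -- it.
    obtain ⟨m₀, hm₀⟩ := hS
    rw [forall₂_congr fun m _ =>
      RiemannCurv.pqCurvature_half_sub_const_iff hr hn (hη m) c]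
    exact ⟨fun H => ⟨fun m hm => (H m hm).1, (H m₀ hm₀).2⟩, fun H m hm => ⟨H.1 m hm, H.2⟩⟩
  · subst h
    exact forall₂_congr fun m _ => RiemannCurv.pqCurvature_half_add_const_iff hr hn (hη m) c
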